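/- **Setting.** Let $p$ be a prime, let $a,b\in[1,p-1]$ be primitive roots modulo $p$ with $ab\equiv 1 \pmod p$, and let $n=\sum_{i=1}^{t}a_ip^{k_i}$ with $k_1>\dots>k_t\ge 0$ and $a_i\in[1,p-1]$ be the $p$-adic expansion of $n\in\mathbb N$. Permutations act on the right, $g^h=h^{-1}gh$, and for a subgroup $P$ of a symmetric group, $\chi\in\mathrm{Irr}(P)$ and $h$ in the normalizer of $P$ we put $\chi^h(g)=\chi(hgh^{-1})$. Let $\tau$ be the permutation of $[0,p]$ fixing $0$ and $p$ with $(x)\tau\equiv bx\pmod p$ for $x\in[1,p-1]$. *Groups.* Let $\gamma=(1,2,\dots,p)$ and $P_p=\langle\gamma\rangle$. For $k\ge1$, divide $[1,p^k]$ into $p$ consecutive blocks of length $p^{k-1}$, and write $(f_1,\dots,f_p;\delta)$ for the elements of $S_{p^{k-1}}\wr S_p\le S_{p^k}$. Put $g_k^{(k)}=(1,\dots,1;\gamma)$ and $g_j^{(k)}=(g_j^{(k-1)},1,\dots,1;1)$ for $1\le j<k$. Then $P_{p^k}=\langle g_1^{(k)},\dots,g_k^{(k)}\rangle=P_{p^{k-1}}\wr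 P_p$ is a Sylow $p$-subgroup of $S_{p^k}$ ($P_1=1$). Let $\sigma_k^{(k)}$ permute the $p$ blocks, preserving positions inside the blocks, as $\tau^{-1}$ permutes $[1,p]$ (that is, $i\mapsto ai \bmod p$), and for $1\le j<k$ let $\sigma_j^{(k)}$ act as $\sigma_j^{(k-1)}$ inside each block. Divide $[1,n]$ into consecutive blocks $(i,j)$, $i\in[1,t]$, $j\in[1,a_i]$, in lexicographic order, the block $(i,j)$ having length $p^{k_i}$; for $h\in S_{p^{k_i}}$ let $h^{\tau(i,j)}\in S_n$ act as $h$ on the block $(i,j)$ and trivially elsewhere. Let $P_n=\prod_{i,j}(P_{p^{k_i}})^{\tau(i,j)}$, a Sylow $p$-subgroup of $S_n$, let $N_n=N_{S_n}(P_n)$, and let $\sigma(i,j,\ell)=(\sigma_\ell^{(k_i)})^{\tau(i,j)}$ for $\ell\in[1,k_i]$. For $y\in[1,t]$ let $\xi_y$ exchange the blocks $(y,1)$ and $(y,2)$ (with $\xi_y=1$ if $a_y=1$) and let $\zeta_y$ permute the blocks $(y,1),\dots,(y,a_y)$ cyclically, both preserving positions inside blocks and fixing all other points. An element $\rho\in\langle\xi_y,\zeta_y\rangle$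 acts on $[1,a_y]$ so that $\big((P_{p^{k_y}})^{\tau(y,x)}\big)^{\rho}=(P_{p^{k_y}})^{\tau(y,(x)\rho)}$. *Tree functions.* A $p^k$-labeling function is a map $t$ from the set of sequences of length $\le k-1$ with entries in $[1,p]$ to $[0,p]$. Two of them are equivalent, $t_1\sim t_2$, if there are $\gamma_{q}\in P_p$, indexed by sequences $q$, with $t_1(s_1\cdots s_\ell)=t_2\big((s_1)\gamma_{\emptyset}\,(s_2)\gamma_{s_1}\cdots(s_\ell)\gamma_{s_1\cdots s_{\ell-1}}\big)$ for all sequences; a $p^k$-tree function is an equivalence class. For $k\ge 1$ write $t=(t_1\mid\dots\mid t_p;x)$ if $t(\emptyset)=x$ and $t_i(q)=t(iq)$, and use the same notation for classes. A tree function is admissible if $k=0$, or if $k\ge1$, its subfunctions $T_1,\dots,T_p$ are admissible, and $T_1,\dots,T_p$ are all equal when $x<p$ and not all equal when $x=p$; $\mathcal F_{p^k}$ is the set of admissible $p^k$-tree functions. Let $\phi_\varepsilon\in\mathrm{Irr}(P_p)$, $\varepsilon\in[0,p-1]$, be given by $\phi_\varepsilon(\gamma)=e^{2\pi i\varepsilon/p}$,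 and let $\mathcal X(\phi;\varepsilon)$ be the character of $P_{p^{k-1}}\wr P_p$ which is the canonical extension of $\phi^{\times p}$ (on the $p$-th tensor power) times the inflation of $\phi_\varepsilon$. The tree function of $\theta\in\mathrm{Irr}(P_{p^k})$ is defined recursively: for $k=0$ it is the unique $1$-tree function; for $k\ge 1$, $\mathcal T(\theta)=(\mathcal T(\phi)\mid\dots\mid\mathcal T(\phi);\varepsilon)$ if $\theta=\mathcal X(\phi;\varepsilon)$ with $\phi\in\mathrm{Irr}(P_{p^{k-1}})$, and $\mathcal T(\theta)=(\mathcal T(\theta_1)\mid\dots\mid\mathcal T(\theta_p);p)$ if $\theta=(\theta_1\times\dots\times\theta_p)\uparrow^{P_{p^k}}$ with $\theta_1,\dots,\theta_p\in\mathrm{Irr}(P_{p^{k-1}})$ not all equal. For $\theta\in\mathrm{Irr}(P_n)$ with $\theta=\prod_{i,j}\theta_{(i,j)}$, $\theta_{(i,j)}\in\mathrm{Irr}(P_{p^{k_i}})$, put $\mathcal T(\theta)=(\mathcal T(\theta_{(i,j)}))_{i,j}$. The normalizers act by $\mathcal T(\theta)^h=\mathcal T(\theta^h)$. **Theorem.**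 Let $\theta\in\mathrm{Irr}(P_n)$. Then $\theta=\prod_{i,j}\theta_{(i,j)}$ with uniquely determined $\theta_{(i,j)}\in\mathrm{Irr}(P_{p^{k_i}})$, and $\mathcal T=\mathcal T(\theta)=(\mathcal T(\theta_{(i,j)}))_{i,j}$ lies in $\mathcal F_n=\prod_{i}(\mathcal F_{p^{k_i}})^{a_i}$. Moreover: 1. Let $i\in[1,t]$, $j\in[1,a_i]$, $\ell\in[1,k_i]$. Then $\sigma(i,j,\ell)\in N_n$, $\sigma_\ell^{(k_i)}\in N_{S_{p^{k_i}}}(P_{p^{k_i}})$, the component $(i,j)$ of $\mathcal T^{\sigma(i,j,\ell)}$ is $\mathcal T(\theta_{(i,j)})^{\sigma_\ell^{(k_i)}}$, and every other component $(i',j')$ is $\mathcal T(\theta_{(i',j')})$. Here the action of $\sigma_\ell^{(k)}$ on $T=(T_1\mid\dots\mid T_p;x)=\mathcal T(\chi)$, $\chi\in\mathrm{Irr}(P_{p^k})$, is given by $$T^{\sigma_\ell^{(k)}}=\begin{cases}(T_1^{\sigma_\ell^{(k-1)}}\mid\dots\mid T_p^{\sigma_\ell^{(k-1)}};x)&\text{if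 }\ell<k,\\ (T_{(1)\tau}\mid\dots\mid T_{(p)\tau};(x)\tau)&\text{if }\ell=k.\end{cases}$$ 2. Let $y\in[1,t]$. Then $\langle\xi_y,\zeta_y\rangle\cong S_{a_y}$, and every $\rho\in\langle\xi_y,\zeta_y\rangle$ lies in $N_n$; the component $(y,j)$ of $\mathcal T^{\rho}$ is $\mathcal T(\theta_{(y,(j)\rho^{-1})})$ for $j\in[1,a_y]$, and every component $(z,j)$ with $z\ne y$ is $\mathcal T(\theta_{(z,j)})$. -/

import Mathlib

open Equiv

namespace SylowTree

/-! ### Irreducible complex characters -/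

section Characters

/-- `χ` is the character of an irreducible complex representation of `G`
(in coordinates: on some `ℂ^d`). -/
def IsIrrChar {G : Type*} [Group G] (χ : G → ℂ) : Prop :=
  ∃ (d : ℕ) (ρ : Representation ℂ G (Fin d → ℂ)), ρ.IsIrreducible ∧ χ = ρ.character

/-- The set `Irr(G)` of irreducible complex characters. -/
def Irr (G : Type*) [Group G] : Type _ := {χ : G → ℂ // IsIrrChar χ}

theorem IsIrrChar.comp_mulEquiv {G : Type*} [Group G] {χ : G → ℂ} (h : IsIrrChar χ)
    (c : G ≃* G) : IsIrrChar (fun g => χ (c g)) := by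
  obtain ⟨d, ρ, hρ, rfl⟩ := h
  refine ⟨d, ρ.comp c.toMonoidHom, ?_, rfl⟩
  let e : Subrepresentation ρ ≃o Subrepresentation (ρ.comp c.toMonoidHom) :=
    { toFun := fun W => ⟨W.toSubmodule, fun g _ hv => W.apply_mem_toSubmodule (c g) hv⟩
      invFun := fun W => ⟨W.toSubmodule, fun g v hv => by
        have := W.apply_mem_toSubmodule (c.symm g) hv
        simpa using this⟩
      left_inv := fun _ => rfl
      right_inv := fun _ => rfl
      map_rel_iff' := Iff.rfl }
  exact (OrderIso.isSimpleOrder_iff e).mp hρ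

/-- Conjugation `x ↦ h⁻¹ * x * h` on a subgroup `H` normalized by `h`. -/
def conjEquiv {G : Type*} [Group G] {H : Subgroup G} {h : G}
    (hh : h ∈ Subgroup.normalizer (H : Set G)) : H ≃* H where
  toFun x := ⟨h⁻¹ * x * h, by
    have := (Subgroup.mem_normalizer_iff.mp (inv_mem hh) x).mp x.2
    simpa using this⟩
  invFun x := ⟨h * x * h⁻¹, (Subgroup.mem_normalizer_iff.mp hh x).mp x.2⟩
  left_inv x := by ext; simp [mul_assoc]
  right_inv x := by ext; simp [mul_assoc]
  map_mul' x y := by ext; simp [mul_assoc]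

/-- The conjugate character `χ^h`. Permutations are composed from right to left here, so
`χ^h(x) = χ(h⁻¹ x h)` is the value of `χ` at the permutation obtained from `x` by relabelling the
points by `h⁻¹`; with permutations composed from left to right, the same permutation is written
`h x h⁻¹`. -/
def Irr.conj {G : Type*} [Group G] {H : Subgroup G} (χ : Irr H) {h : G}
    (hh : h ∈ Subgroup.normalizer (H : Set G)) : Irr H :=
  ⟨fun x => χ.1 (conjEquiv hh x), χ.2.comp_mulEquiv (conjEquiv hh)⟩

open Classical in
/-- The class function of the finite group `G` induced by `ψ : H → ℂ`. -/
noncomputable def induced {G : Type*} [Group G] (H : Subgroup G) (ψ : H → ℂ) (g : G) : ℂ :=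
  (Nat.card H : ℂ)⁻¹ * ∑ᶠ x : G, if hx : x⁻¹ * g * x ∈ H then ψ ⟨x⁻¹ * g * x, hx⟩ else 0

open scoped TensorProduct in
/-- The operator `v₁ ⊗ ⋯ ⊗ vₚ ↦ f₁ v_{s⁻¹(1)} ⊗ ⋯ ⊗ fₚ v_{s⁻¹(p)}` of the element `(f; s)` of a wreath
product on the tensor power of a representation `ρ` of the base factor. -/
noncomputable def wreathTensor {G V : Type*} [Group G] [AddCommGroup V] [Module ℂ V] {p : ℕ}
    (ρ : Representation ℂ G V) (f : Fin p → G) (s : Perm (Fin p)) :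
    (⨂[ℂ] _ : Fin p, V) →ₗ[ℂ] (⨂[ℂ] _ : Fin p, V) :=
  (PiTensorProduct.map fun i => ρ (f i)) ∘ₗ
    (PiTensorProduct.reindex ℂ (fun _ : Fin p => V) s).toLinearMap

end Characters

/-! ### The Sylow subgroup of `S_{p^k}` and the elements of its normalizer

Points, blocks and sequence entries are numbered from `0`: the element `x` of `Fin m` stands for the
element `x + 1` of `[1, m]`. -/

section PrimePower

variable (p : ℕ)

/-- The point with offset `r` in the `i`-th block of length `p ^ k` is `r + p ^ k * i`. -/
def blockEquiv (k : ℕ) : Fin p × Fin (p ^ k) ≃ Fin (p ^ (k + 1)) :=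
  finProdFinEquiv.trans (finCongr (pow_succ' p k).symm)

variable {p}

/-- The permutation `(f; s)` of the points: block `i` goes to block `s i`, and then `f (s i)` is
applied inside this block. -/
def wr {k : ℕ} (f : Fin p → Perm (Fin (p ^ k))) (s : Perm (Fin p)) : Perm (Fin (p ^ (k + 1))) :=
  (blockEquiv p k).permCongr (Equiv.prodShear s fun i => f (s i))

theorem wr_mul {k : ℕ} (f g : Fin p → Perm (Fin (p ^ k))) (s t : Perm (Fin p)) :
    wr f s * wr g t = wr (fun i => f i * g (s⁻¹ i)) (s * t) := by
  ext x
  obtain ⟨⟨i, r⟩, rfl⟩ := (blockEquiv p k).surjective x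
  simp [wr, Equiv.permCongr_apply, Equiv.prodShear]

theorem wr_one {k : ℕ} : wr (1 : Fin p → Perm (Fin (p ^ k))) 1 = 1 := by
  ext x
  obtain ⟨⟨i, r⟩, rfl⟩ := (blockEquiv p k).surjective x
  simp [wr, Equiv.permCongr_apply, Equiv.prodShear]

variable (p) [Fact p.Prime]

/-- The group `P_p` generated by the cycle `γ = (1, 2, …, p)`. -/
def cyc : Subgroup (Perm (Fin p)) := Subgroup.zpowers (finRotate p)

/-- The permutations `g_j^{(k)}`, for `1 ≤ j ≤ k`: `g_k^{(k)} = (1, …, 1; γ)` and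
`g_j^{(k)} = (g_j^{(k-1)}, 1, …, 1; 1)` for `j < k`. -/
def gen : (k j : ℕ) → Perm (Fin (p ^ k))
  | 0, _ => 1
  | k + 1, j => if j = k + 1 then wr 1 (finRotate p) else wr (Pi.mulSingle 0 (gen k j)) 1

/-- The Sylow `p`-subgroup `P_{p^k}` of `S_{p^k}`. -/
def P (k : ℕ) : Subgroup (Perm (Fin (p ^ k))) :=
  Subgroup.closure {g | ∃ j, 1 ≤ j ∧ j ≤ k ∧ g = gen p k j}

variable {p}

/-- Every element of `P_{p^(k+1)}` has the form `(f; s)` of an element of `P_{p^k} ≀ P_p`. -/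
theorem exists_wr {k : ℕ} {x : Perm (Fin (p ^ (k + 1)))} (hx : x ∈ P p (k + 1)) :
    ∃ (f : Fin p → P p k) (s : cyc p), x = wr (fun i => (f i : Perm (Fin (p ^ k)))) s := by
  induction hx using Subgroup.closure_induction with
  | mem x hx =>
    obtain ⟨j, hj1, hj2, rfl⟩ := hx
    by_cases hj : j = k + 1
    · exact ⟨1, ⟨finRotate p, Subgroup.mem_zpowers _⟩, by simp [gen, hj, Pi.one_def]⟩
    · refine ⟨Pi.mulSingle 0 ⟨gen p k j, Subgroup.subset_closure ⟨j, hj1, by omega, rfl⟩⟩, 1, ?_⟩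
      have : (fun i => (((Pi.mulSingle 0
          ⟨gen p k j, Subgroup.subset_closure ⟨j, hj1, by omega, rfl⟩⟩ : Fin p → P p k) i : P p k)
            : Perm (Fin (p ^ k)))) = Pi.mulSingle 0 (gen p k j) := by
        funext i
        by_cases hi : i = 0
        · subst hi; simp
        · simp [Pi.mulSingle_eq_of_ne hi]
      rw [this]
      simp [gen, hj]
  | one => exact ⟨1, 1, by simpa using! wr_one.symm⟩
  | mul x y _ _ ihx ihy =>
    obtain ⟨f, s, rfl⟩ := ihx
    obtain ⟨g, t, rfl⟩ := ihy
    exact ⟨fun i => f i * g ((s : Perm (Fin p))⁻¹ i), s * t, by rw [wr_mul]; simp⟩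
  | inv x _ ih =>
    obtain ⟨f, s, rfl⟩ := ih
    refine ⟨fun i => (f ((s : Perm (Fin p)) i))⁻¹, s⁻¹, ?_⟩
    rw [inv_eq_iff_mul_eq_one, wr_mul]
    simpa using! wr_one

/-- The components `f_1, …, f_p` of an element `(f; s)` of `P_{p^(k+1)}`. -/
noncomputable def base {k : ℕ} (x : P p (k + 1)) : Fin p → P p k := (exists_wr x.2).choose

/-- The component `s` of an element `(f; s)` of `P_{p^(k+1)}`. -/
noncomputable def top {k : ℕ} (x : P p (k + 1)) : cyc p := (exists_wr x.2).choose_spec.choose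

/-- The embedding `f ↦ (f; 1)` of the base group `(P_{p^k})^p`. -/
def baseHom (k : ℕ) : (Fin p → P p k) →* Perm (Fin (p ^ (k + 1))) where
  toFun f := wr (fun i => (f i : Perm (Fin (p ^ k)))) 1
  map_one' := wr_one
  map_mul' f g := by rw [wr_mul]; simp

/-- The base group, as a subgroup of `P_{p^(k+1)}`. -/
def baseGroup (k : ℕ) : Subgroup (P p (k + 1)) := (baseHom k).range.subgroupOf (P p (k + 1))

/-- The linear character `φ_ε` of `P_p`, with `φ_ε(γ ^ m) = ω ^ (ε m)` for `ω = exp(2πi/p)`;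
note that `γ ^ m` sends `0` to the residue of `m`. -/
noncomputable def phi (ε : Fin p) (s : cyc p) : ℂ :=
  Complex.exp (2 * Real.pi * Complex.I / p) ^ ((ε : ℕ) * (((s : Perm (Fin p)) 0 : Fin p) : ℕ))

/-- The character `𝒳(φ; ε)` of `P_{p^(k+1)} = P_{p^k} ≀ P_p`: the character of the tensor power of a
module affording `φ`, multiplied by the inflation of `φ_ε`. -/
noncomputable def calX {k : ℕ} (φ : Irr (P p k)) (ε : Fin p) (x : P p (k + 1)) : ℂ :=
  LinearMap.trace ℂ _ (wreathTensor φ.2.choose_spec.choose (base x) (top x)) * phi ε (top x)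

/-- The character `(θ_1 × ⋯ × θ_p)↑` of `P_{p^(k+1)}`, induced from the base group. -/
noncomputable def indProd {k : ℕ} (θ : Fin p → Irr (P p k)) : P p (k + 1) → ℂ :=
  induced (baseGroup k) fun x => ∏ i, (θ i).1 (base x.1 i)

variable (p) in
/-- The element `i` of `Fin p` stands for `i + 1 ∈ [1, p]`; this is its residue class mod `p`. -/
def residue : Fin p ≃ ZMod p := (ZMod.finEquiv p).toEquiv.trans (Equiv.addRight 1)

/-- The permutation `i ↦ u i mod p` of `[1, p]`. For a primitive root `u ≡ a` it is the
cycle `σ_1^{(1)} = (a_1, …, a_{p-1})` with `a_i ≡ a ^ i`. -/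
def mulPerm (u : (ZMod p)ˣ) : Perm (Fin p) := (residue p).symm.permCongr (Units.mulLeft u)

/-- The permutations `σ_j^{(k)}`, for `1 ≤ j ≤ k`: `σ_k^{(k)}` permutes the `p` blocks of length
`p ^ (k-1)` as `σ_1^{(1)}` permutes `[1, p]`, and `σ_j^{(k)}`, for `j < k`, acts as `σ_j^{(k-1)}` in
each of these blocks. -/
def sigma (u : (ZMod p)ˣ) : (k j : ℕ) → Perm (Fin (p ^ k))
  | 0, _ => 1
  | k + 1, j => if j = k + 1 then wr 1 (mulPerm u) else wr (fun _ => sigma u k j) 1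

end PrimePower

/-! ### Tree functions -/

section Trees

variable (p : ℕ)

/-- The `p^k`-skeleton: sequences of length at most `k - 1` with entries in `[1, p]`. -/
def Skeleton (k : ℕ) : Type := {s : List (Fin p) // s.length < k}

/-- The `p^k`-labeling functions, with labels in `[0, p]`. -/
def Labeling (k : ℕ) : Type := Skeleton p k → Fin (p + 1)

variable {p}

namespace Labeling

/-- The label `t(∅)` of the empty sequence. -/
def root {k : ℕ} (t : Labeling p (k + 1)) : Fin (p + 1) := t ⟨[], Nat.succ_pos k⟩

/-- The labeling subfunction of `t` rooted at the sequence `i` of length one. -/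
def sub {k : ℕ} (t : Labeling p (k + 1)) (i : Fin p) : Labeling p k :=
  fun q => t ⟨i :: q.1, Nat.succ_lt_succ q.2⟩

/-- The labeling function `(f_1 ∣ ⋯ ∣ f_p; ε)`. -/
def node {k : ℕ} (f : Fin p → Labeling p k) (ε : Fin (p + 1)) : Labeling p (k + 1)
  | ⟨[], _⟩ => ε
  | ⟨i :: q, h⟩ => f i ⟨q, Nat.lt_of_succ_lt_succ h⟩

end Labeling

/-- The sequence `(s_1)γ_∅ (s_2)γ_{s_1} (s_3)γ_{s_1 s_2} ⋯` obtained from `s = s_1 s_2 s_3 ⋯`. -/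
def twist : (List (Fin p) → Perm (Fin p)) → List (Fin p) → List (Fin p)
  | _, [] => []
  | γ, x :: s => γ [] x :: twist (fun q => γ (x :: q)) s

@[simp] theorem length_twist (γ : List (Fin p) → Perm (Fin p)) (s : List (Fin p)) :
    (twist γ s).length = s.length := by
  induction s generalizing γ with
  | nil => rfl
  | cons x s ih => simp [twist, ih]

/-- The sequence `twist γ s`, as an element of the skeleton. -/
def Skeleton.twist {k : ℕ} (γ : List (Fin p) → Perm (Fin p)) (s : Skeleton p k) : Skeleton p k :=
  ⟨SylowTree.twist γ s.1, by rw [length_twist]; exact s.2⟩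

theorem twist_one (s : List (Fin p)) : twist (fun _ => 1) s = s := by
  induction s with
  | nil => rfl
  | cons x s ih => simp [twist, ih]

theorem twist_twist (γ δ : List (Fin p) → Perm (Fin p)) (s : List (Fin p)) :
    twist δ (twist γ s) = twist (fun q => δ (twist γ q) * γ q) s := by
  induction s generalizing γ δ with
  | nil => rfl
  | cons x s ih => simp [twist, ih]

/-- The family inverse to `γ` with respect to `twist`. -/
def invTwist : (List (Fin p) → Perm (Fin p)) → List (Fin p) → Perm (Fin p)
  | γ, [] => (γ [])⁻¹
  | γ, y :: q => invTwist (fun r => γ ((γ [])⁻¹ y :: r)) q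

theorem twist_invTwist (γ : List (Fin p) → Perm (Fin p)) (s : List (Fin p)) :
    twist γ (twist (invTwist γ) s) = s := by
  induction s generalizing γ with
  | nil => rfl
  | cons x s ih => simpa [twist, invTwist] using ih _

theorem invTwist_mem {H : Subgroup (Perm (Fin p))} (γ : List (Fin p) → Perm (Fin p))
    (h : ∀ q, γ q ∈ H) (q : List (Fin p)) : invTwist γ q ∈ H := by
  induction q generalizing γ with
  | nil => exact inv_mem (h [])
  | cons y q ih => exact ih _ fun r => h _

variable (p) [Fact p.Prime]

/-- The equivalence relation on labeling functions: `t₁ ∼ t₂` if there are `γ_q ∈ P_p` with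
`t₁(s) = t₂((s_1)γ_∅ (s_2)γ_{s_1} ⋯)` for all `s`. Only the `γ_q` with `q` of length
less than `k - 1` matter, and the case `s = ∅` says `t₁(∅) = t₂(∅)`. -/
instance treeSetoid (k : ℕ) : Setoid (Labeling p k) where
  r t₁ t₂ := ∃ γ : List (Fin p) → Perm (Fin p), (∀ q, γ q ∈ cyc p) ∧
    ∀ s : Skeleton p k, t₁ s = t₂ (s.twist γ)
  iseqv :=
    { refl := fun t => ⟨fun _ => 1, fun _ => one_mem _, fun s =>
        congrArg t (Subtype.ext (twist_one s.1).symm)⟩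
      symm := by
        rintro t₁ t₂ ⟨γ, hγ, h⟩
        refine ⟨invTwist γ, invTwist_mem γ hγ, fun s => ?_⟩
        rw [h]
        exact congrArg t₂ (Subtype.ext (twist_invTwist γ s.1).symm)
      trans := by
        rintro t₁ t₂ t₃ ⟨γ, hγ, h⟩ ⟨δ, hδ, h'⟩
        refine ⟨fun q => δ (twist γ q) * γ q, fun q => mul_mem (hδ _) (hγ _), fun s => ?_⟩
        rw [h, h']
        exact congrArg t₃ (Subtype.ext (twist_twist γ δ s.1)) }

/-- The `p^k`-tree functions: equivalence classes of `p^k`-labeling functions. -/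
def TreeFun (k : ℕ) : Type := Quotient (treeSetoid p k)

variable {p}

/-- The tree function of a labeling function. -/
def Labeling.toTree {k : ℕ} (t : Labeling p k) : TreeFun p k := Quotient.mk (treeSetoid p k) t

namespace TreeFun

/-- The tree function `(F_1 ∣ ⋯ ∣ F_p; ε)`, formed with representatives of `F_1, …, F_p`. -/
noncomputable def node {k : ℕ} (F : Fin p → TreeFun p k) (ε : Fin (p + 1)) : TreeFun p (k + 1) :=
  (Labeling.node (fun i => Quotient.out (F i)) ε).toTree

end TreeFun

/-- Admissible labeling functions. All subfunctions rooted at sequences of length one have to be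
admissible, and their classes are all equal if `t(∅) ∈ [0, p-1]`, and not all equal if `t(∅) = p`.
The skeleton is empty for `k = 0`, so for `k = 1` the condition is `t(∅) ∈ [0, p-1]`. -/
def Labeling.Admissible : {k : ℕ} → Labeling p k → Prop
  | 0, _ => True
  | _ + 1, t => (∀ i, Labeling.Admissible (t.sub i)) ∧
      (t.root ≠ Fin.last p → ∀ i j, (t.sub i).toTree = (t.sub j).toTree) ∧
      (t.root = Fin.last p → ¬ ∀ i j, (t.sub i).toTree = (t.sub j).toTree)

variable (p) in
/-- The set `ℱ_{p^k}` of admissible tree functions. -/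
def admissibleTrees (k : ℕ) : Set (TreeFun p k) :=
  {T | ∀ t : Labeling p k, t.toTree = T → t.Admissible}

open Classical in
/-- The tree function `𝒯(θ)` of an irreducible character of `P_{p^k}`. For `k = 0` there is only one
tree function. An irreducible character of `P_{p^(k+1)}` is either `𝒳(φ; ε)`, and then its tree
function is `(𝒯(φ) ∣ ⋯ ∣ 𝒯(φ); ε)`, or `(θ_1 × ⋯ × θ_p)↑` with `θ_1, …, θ_p` not all equal, and then
its tree function is `(𝒯(θ_1) ∣ ⋯ ∣ 𝒯(θ_p); p)`. The last alternative never occurs. -/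
noncomputable def tree : {k : ℕ} → Irr (P p k) → TreeFun p k
  | 0, _ => Labeling.toTree fun _ => 0
  | k + 1, θ =>
    if h : ∃ (φ : Irr (P p k)) (ε : Fin p), θ.1 = calX φ ε then
      TreeFun.node (fun _ => tree h.choose) h.choose_spec.choose.castSucc
    else if h : ∃ θs : Fin p → Irr (P p k), (¬ ∀ i j, θs i = θs j) ∧ θ.1 = indProd θs then
      TreeFun.node (fun i => tree (h.choose i)) (Fin.last p)
    else Labeling.toTree fun _ => 0

/-- The permutation `τ = (σ_1^{(1)})⁻¹` of the labels: `ε ↦ u⁻¹ ε mod p` on `[0, p-1]`, and `p` is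
fixed. -/
def tauLabel (u : (ZMod p)ˣ) (x : Fin (p + 1)) : Fin (p + 1) :=
  if x = Fin.last p then Fin.last p else
    ⟨(((u⁻¹ : (ZMod p)ˣ) : ZMod p) * ((x : ℕ) : ZMod p)).val, (ZMod.val_lt _).trans (Nat.lt_succ_self p)⟩

/-- The explicit action of `σ_j^{(k)}` on labeling functions: a labeling function
`(t_1 ∣ ⋯ ∣ t_p; x)` goes to `(t_{(1)τ} ∣ ⋯ ∣ t_{(p)τ}; (x)τ)` if `j = k`, and to the labeling function
`(t_1^{σ_j^{(k-1)}} ∣ ⋯ ∣ t_p^{σ_j^{(k-1)}}; x)` if `j < k`. -/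
def Labeling.sigmaAct (u : (ZMod p)ˣ) : {k : ℕ} → (j : ℕ) → Labeling p k → Labeling p k
  | 0, _, t => t
  | k + 1, j, t =>
    if j = k + 1 then Labeling.node (fun i => t.sub ((mulPerm u)⁻¹ i)) (tauLabel u t.root)
    else Labeling.node (fun i => Labeling.sigmaAct u j (t.sub i)) t.root

end Trees

/-! ### The Sylow subgroup of `S_n` -/

/-- The `p`-adic expansion `n = ∑ a_i p^{k_i}` with `k_1 > ⋯ > k_t ≥ 0` and `a_i ∈ [1, p-1]`. -/
structure PadicExpansion (p n : ℕ) where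
  t : ℕ
  a : Fin t → ℕ
  k : Fin t → ℕ
  k_anti : StrictAnti k
  a_pos : ∀ i, 1 ≤ a i
  a_le : ∀ i, a i ≤ p - 1
  sum_eq : ∑ i, a i * p ^ k i = n

namespace PadicExpansion

variable {p n : ℕ} (E : PadicExpansion p n)

/-- The point `(i, j, x)` is `x + p^{k_i} * j + ∑_{z < i} a_z p^{k_z}`: the point with offset `x` in
the `j`-th block of length `p^{k_i}`. -/
def point : (Σ i, Fin (E.a i) × Fin (p ^ E.k i)) ≃ Fin n :=
  (Equiv.sigmaCongrRight fun _ => finProdFinEquiv).trans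
    (finSigmaFinEquiv.trans (finCongr E.sum_eq))

/-- The permutation acting as `h i j` on the block `(i, j)`. -/
def blockHom : (∀ i, Fin (E.a i) → Perm (Fin (p ^ E.k i))) →* Perm (Fin n) where
  toFun h := E.point.permCongr
    (Equiv.Perm.sigmaCongrRight fun i => Equiv.prodShear (Equiv.refl _) (h i))
  map_one' := by
    ext x
    obtain ⟨⟨i, j, r⟩, rfl⟩ := E.point.surjective x
    simp [Equiv.permCongr_apply, Equiv.prodShear]
  map_mul' f g := by
    ext x
    obtain ⟨⟨i, j, r⟩, rfl⟩ := E.point.surjective x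
    simp [Equiv.permCongr_apply, Equiv.prodShear]

/-- The map `h ↦ h^{τ(i,j)}`, which makes a permutation of `[1, p^{k_i}]` act on the block `(i, j)`. -/
def shiftHom (i : Fin E.t) (j : Fin (E.a i)) : Perm (Fin (p ^ E.k i)) →* Perm (Fin n) :=
  E.blockHom.comp ((MonoidHom.mulSingle _ i).comp (MonoidHom.mulSingle (fun _ : Fin (E.a i) => Perm (Fin (p ^ E.k i))) j))

/-- The permutation of `[1, n]` that permutes the `a_i` blocks of length `p^{k_i}` by `π`, preserving
the offset of each point in its block. -/
def permBlocks (i : Fin E.t) (π : Perm (Fin (E.a i))) : Perm (Fin n) :=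
  E.point.permCongr (Equiv.Perm.sigmaCongrRight (Pi.mulSingle i (Equiv.prodCongr π (Equiv.refl _))))

/-- `ξ_i` exchanges the first two blocks of length `p^{k_i}` (and is `1` if `a_i = 1`). -/
def xi (i : Fin E.t) : Perm (Fin n) :=
  if h : 2 ≤ E.a i then
    E.permBlocks i (Equiv.swap ⟨0, Nat.lt_of_lt_of_le Nat.zero_lt_two h⟩ ⟨1, h⟩)
  else 1

/-- `ζ_i` permutes the blocks of length `p^{k_i}` cyclically. -/
def zeta (i : Fin E.t) : Perm (Fin n) := E.permBlocks i (finRotate (E.a i))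

/-- The group `⟨ξ_i, ζ_i⟩`. -/
def rhoGroup (i : Fin E.t) : Subgroup (Perm (Fin n)) := Subgroup.closure {E.xi i, E.zeta i}

variable [Fact p.Prime]

/-- The embedding of the direct product of the groups `P_{p^{k_i}}` in `S_n`. -/
def prodHom : (∀ i, Fin (E.a i) → P p (E.k i)) →* Perm (Fin n) where
  toFun x := E.blockHom fun i j => (x i j : Perm (Fin (p ^ E.k i)))
  map_one' := E.blockHom.map_one
  map_mul' _ _ := E.blockHom.map_mul _ _

/-- The Sylow `p`-subgroup `P_n = ∏ (P_{p^{k_i}})^{τ(i,j)}` of `S_n`. -/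
def sylow : Subgroup (Perm (Fin n)) := E.prodHom.range

/-- The direct factor `(P_{p^{k_i}})^{τ(i,j)}` of `P_n`. -/
def factor (i : Fin E.t) (j : Fin (E.a i)) : Subgroup (Perm (Fin n)) :=
  (P p (E.k i)).map (E.shiftHom i j)

/-- The normalizer `N_n` of `P_n` in `S_n`. -/
def N : Subgroup (Perm (Fin n)) := Subgroup.normalizer (E.sylow : Set (Perm (Fin n)))

/-- `σ(i,j,ℓ) = (σ_ℓ^{(k_i)})^{τ(i,j)}`. -/
def sigma (u : (ZMod p)ˣ) (i : Fin E.t) (j : Fin (E.a i)) (ℓ : ℕ) : Perm (Fin n) :=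
  E.shiftHom i j (SylowTree.sigma u (E.k i) ℓ)

/-- `θ` is the direct product of the characters `θs i j` of the direct factors of `P_n`. -/
def IsProd (θ : Irr E.sylow) (θs : ∀ i, Fin (E.a i) → Irr (P p (E.k i))) : Prop :=
  ∀ x : ∀ i, Fin (E.a i) → P p (E.k i),
    θ.1 (E.prodHom.rangeRestrict x) = ∏ i, ∏ j, (θs i j).1 (x i j)

open Classical in
/-- The tree function `𝒯(θ)`, the tuple of the tree functions of the factors of `θ`. Every irreducible
character of `P_n` is such a product, so the second alternative never occurs. -/
noncomputable def tree (θ : Irr E.sylow) : ∀ i, Fin (E.a i) → TreeFun p (E.k i) :=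
  if h : ∃ θs, E.IsProd θ θs then fun i j => SylowTree.tree (h.choose i j)
  else fun _ _ => Labeling.toTree fun _ => 0

/-- The permutation `π` of `[1, a_i]` is induced by `ρ`: for all `x`,
the conjugate of the direct factor `(i, x)` by `ρ` is the direct factor `(i, π x)`. -/
def Induces (i : Fin E.t) (ρ : Perm (Fin n)) (π : Perm (Fin (E.a i))) : Prop :=
  ∀ x, (E.factor i x).map (MulAut.conj ρ).toMonoidHom = E.factor i (π x)

end PadicExpansion

end SylowTree

namespace SylowTree

/-! ### Characters of finite groups -/

section CharacterTheory

open Module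

variable {G : Type*} [Group G]

/-! Everything rests on the irreducible characters of a wreath product `P_{p^(k+1)} = P_{p^k} ≀
P_p`. Restrict such a character `θ` to the base group and pick a constituent `θ_1 × ⋯ × θ_p`; by
Frobenius reciprocity (`cip_indProd`) `θ` occurs in the function induced from it. If the `θ_i` are
not all equal, their `p` rotations are distinct because `p` is prime, so the induced function has
norm one and equals `θ`. If all are equal to `φ`, the induced function is the sum of the irreducible
characters `𝒳(φ; ε)`, and `θ` is one of them. This is `irr_succ_cases`.

The two types are separated by vanishing outside the base group. In the first type the tuple is
determined up to rotation (`exists_cyc_of_indProd_eq`), in the second `φ` and `ε` are determined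
(`calX_injective`). Rotation at every level is exactly what equivalence of labeling functions
divides out (`Labeling.toTree_succ_eq_iff`), so tree functions do not depend on choices, are
injective on characters (`tree_injective`), and are admissible.

Conjugation by an element `(h, …, h; m)` respects the two types: `calX_conj` and `indProd_conj` give
`𝒳(φ; ε) ↦ 𝒳(φ^h; ε')` and `(θ_i) ↦ (θ_{m⁻¹ i}^h)`. Each `σ_ℓ` has this form, with `h = 1` or `m =
1`. Multiplication by `u` conjugates the translation by `c` into the translation by `u⁻¹ c`, which
is why the labels move by `τ` (`phi_conj_mulPerm`). Induction on `k` gives `tree_conj_sigma`.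

Finally `P_n` is a direct product, so its irreducible characters are unique products of irreducible
characters of the factors. The `σ(i,j,ℓ)` act inside one factor, and `⟨ξ_y, ζ_y⟩` is the image of a
full symmetric group permuting isomorphic factors. -/

/-- `χ` is the character of a finite-dimensional complex representation of `G`. -/
def IsChar (χ : G → ℂ) : Prop :=
  ∃ (d : ℕ) (ρ : Representation ℂ G (Fin d → ℂ)), χ = ρ.character

/-- Transport of a representation along a linear equivalence. -/
noncomputable def transportRep {V W : Type*} [AddCommGroup V] [Module ℂ V] [AddCommGroup W]
    [Module ℂ W] (ρ : Representation ℂ G V) (e : V ≃ₗ[ℂ] W) : Representation ℂ G W :=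
  (e.conjRingEquiv : End ℂ V →* End ℂ W).comp ρ

theorem transportRep_apply {V W : Type*} [AddCommGroup V] [Module ℂ V] [AddCommGroup W]
    [Module ℂ W] (ρ : Representation ℂ G V) (e : V ≃ₗ[ℂ] W) (g : G) :
    transportRep ρ e g = e.conj (ρ g) := rfl

theorem transportRep_character {V W : Type*} [AddCommGroup V] [Module ℂ V] [AddCommGroup W]
    [Module ℂ W] (ρ : Representation ℂ G V) (e : V ≃ₗ[ℂ] W) :
    (transportRep ρ e).character = ρ.character := by
  funext g
  simp [Representation.character, transportRep_apply, LinearMap.trace_conj']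

theorem isIrreducible_transportRep {V W : Type*} [AddCommGroup V] [Module ℂ V] [AddCommGroup W]
    [Module ℂ W] (ρ : Representation ℂ G V) (e : V ≃ₗ[ℂ] W) (h : ρ.IsIrreducible) :
    (transportRep ρ e).IsIrreducible := by
  let o : Subrepresentation ρ ≃o Subrepresentation (transportRep ρ e) :=
    { toFun := fun U => ⟨U.toSubmodule.map e.toLinearMap, by
        rintro g _ ⟨v, hv, rfl⟩
        exact ⟨ρ g v, U.apply_mem_toSubmodule g hv, by simp [transportRep_apply]⟩⟩
      invFun := fun U => ⟨U.toSubmodule.comap e.toLinearMap, by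
        intro g v hv
        have := U.apply_mem_toSubmodule g hv
        simpa [transportRep_apply] using this⟩
      left_inv := fun U => Subrepresentation.toSubmodule_injective
        (Submodule.comap_map_eq_of_injective e.injective _)
      right_inv := fun U => Subrepresentation.toSubmodule_injective
        (Submodule.map_comap_eq_of_surjective e.surjective _)
      map_rel_iff' := Submodule.map_le_map_iff_of_injective e.injective _ _ }
  exact (OrderIso.isSimpleOrder_iff o).mp h

section

variable {V : Type*} [AddCommGroup V] [Module ℂ V] [FiniteDimensional ℂ V]

/-- A basis moves `V` to coordinates, so subrepresentations, tensor products and function spaces can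
be used although `IsChar` only allows `ℂ^d`. -/
theorem isChar_character (ρ : Representation ℂ G V) : IsChar ρ.character :=
  ⟨finrank ℂ V, transportRep ρ (finBasis ℂ V).equivFun, (transportRep_character _ _).symm⟩

theorem isIrrChar_character (ρ : Representation ℂ G V) (h : ρ.IsIrreducible) :
    IsIrrChar ρ.character :=
  ⟨finrank ℂ V, transportRep ρ (finBasis ℂ V).equivFun, isIrreducible_transportRep _ _ h,
    (transportRep_character _ _).symm⟩

end

theorem IsIrrChar.isChar {χ : G → ℂ} (h : IsIrrChar χ) : IsChar χ := by
  obtain ⟨d, ρ, _, rfl⟩ := h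
  exact ⟨d, ρ, rfl⟩

theorem IsChar.comp_hom {H : Type*} [Group H] {χ : G → ℂ} (h : IsChar χ) (f : H →* G) :
    IsChar (χ ∘ f) := by
  obtain ⟨d, ρ, rfl⟩ := h
  exact ⟨d, ρ.comp f, rfl⟩

theorem isIrreducible_comp_mulEquiv {H V : Type*} [Group H] [AddCommGroup V] [Module ℂ V]
    {ρ : Representation ℂ G V} (hρ : ρ.IsIrreducible) (c : H ≃* G) :
    Representation.IsIrreducible (ρ.comp c.toMonoidHom) := by
  let e : Subrepresentation ρ ≃o Subrepresentation (ρ.comp c.toMonoidHom) :=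
    { toFun := fun W => ⟨W.toSubmodule, fun g _ hv => W.apply_mem_toSubmodule (c g) hv⟩
      invFun := fun W => ⟨W.toSubmodule, fun g v hv => by
        have := W.apply_mem_toSubmodule (c.symm g) hv
        simpa using this⟩
      left_inv := fun _ => rfl
      right_inv := fun _ => rfl
      map_rel_iff' := Iff.rfl }
  exact (OrderIso.isSimpleOrder_iff e).mp hρ

theorem IsIrrChar.comp_equiv {H : Type*} [Group H] {χ : G → ℂ} (h : IsIrrChar χ) (c : H ≃* G) :
    IsIrrChar (χ ∘ c) := by
  obtain ⟨d, ρ, hρ, rfl⟩ := h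
  exact ⟨d, ρ.comp c.toMonoidHom, isIrreducible_comp_mulEquiv hρ c, rfl⟩

theorem IsChar.mul {χ ψ : G → ℂ} (h : IsChar χ) (h' : IsChar ψ) : IsChar (χ * ψ) := by
  obtain ⟨d, ρ, rfl⟩ := h
  obtain ⟨e, σ, rfl⟩ := h'
  rw [← Representation.char_tensor]
  exact isChar_character _

theorem isChar_one : IsChar (1 : G → ℂ) := by
  refine ⟨1, Representation.trivial ℂ G (Fin 1 → ℂ), ?_⟩
  funext g
  simp [Representation.character]

theorem isChar_zero : IsChar (0 : G → ℂ) := by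
  refine ⟨0, Representation.trivial ℂ G (Fin 0 → ℂ), ?_⟩
  funext g
  simp [Representation.character]

theorem IsChar.add {χ ψ : G → ℂ} (h : IsChar χ) (h' : IsChar ψ) : IsChar (χ + ψ) := by
  obtain ⟨d, ρ, rfl⟩ := h
  obtain ⟨e, σ, rfl⟩ := h'
  have : ρ.character + σ.character = (ρ.prod σ).character := by
    funext g
    exact (LinearMap.trace_prodMap' (ρ g) (σ g)).symm
  rw [this]
  exact isChar_character _

theorem isChar_prod {ι : Type*} (s : Finset ι) {χ : ι → G → ℂ} (h : ∀ i, IsChar (χ i)) :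
    IsChar (fun g => ∏ i ∈ s, χ i g) := by
  classical
  induction s using Finset.induction_on with
  | empty => simpa using! isChar_one
  | insert a s ha ih =>
    simp only [Finset.prod_insert ha]
    exact (h a).mul ih

theorem isChar_sum {ι : Type*} (s : Finset ι) {χ : ι → G → ℂ} (h : ∀ i, IsChar (χ i)) :
    IsChar (fun g => ∑ i ∈ s, χ i g) := by
  classical
  induction s using Finset.induction_on with
  | empty => simpa using! isChar_zero
  | insert a s ha ih =>
    simp only [Finset.sum_insert ha]
    exact (h a).add ih

theorem IsChar.conj_invariant {χ : G → ℂ} (h : IsChar χ) (g x : G) :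
    χ (x⁻¹ * g * x) = χ g := by
  obtain ⟨d, ρ, rfl⟩ := h
  simpa using ρ.char_conj g x⁻¹

/-- The value at `1` is the dimension of the representation. -/
theorem IsChar.eq_zero_of_apply_one {χ : G → ℂ} (h : IsChar χ) (h1 : χ 1 = 0) : χ = 0 := by
  obtain ⟨d, ρ, rfl⟩ := h
  have hd : d = 0 := by simpa using h1
  subst hd
  funext g
  have : ρ g = 0 := Subsingleton.elim _ _
  simp [Representation.character, this]

theorem IsIrrChar.apply_one_ne_zero {χ : G → ℂ} (h : IsIrrChar χ) : χ 1 ≠ 0 := by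
  obtain ⟨d, ρ, hρ, rfl⟩ := h
  intro h1
  have hd : d = 0 := by simpa using h1
  subst hd
  obtain ⟨⟨U, W, hUW⟩⟩ := hρ.toNontrivial
  exact hUW (Subrepresentation.toSubmodule_injective (Subsingleton.elim _ _))

/-- If two representations form a direct sum decomposition, the characters add up. -/
theorem character_eq_add_of_isCompl {V : Type*} [AddCommGroup V] [Module ℂ V]
    [FiniteDimensional ℂ V] (ρ : Representation ℂ G V) (U W : Subrepresentation ρ)
    (h : IsCompl U.toSubmodule W.toSubmodule) :
    ρ.character = U.toRepresentation.character + W.toRepresentation.character := by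
  funext g
  have : ρ g = (Submodule.prodEquivOfIsCompl _ _ h).conj
      ((U.toRepresentation g).prodMap (W.toRepresentation g)) := by
    ext v
    obtain ⟨⟨a, b⟩, rfl⟩ := (Submodule.prodEquivOfIsCompl _ _ h).surjective v
    rw [LinearEquiv.conj_apply_apply, LinearEquiv.symm_apply_apply]
    simp [Subrepresentation.toRepresentation]
  rw [Representation.character, this, LinearMap.trace_conj', LinearMap.trace_prodMap']
  rfl

/-! ### Orthogonality, complete reducibility and norms of characters. -/

variable [Fintype G]

/-- The bilinear form `[χ, ψ] = |G|⁻¹ ∑ χ(g) ψ(g⁻¹)` on functions on `G`. -/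
noncomputable def cip (χ ψ : G → ℂ) : ℂ := (Nat.card G : ℂ)⁻¹ * ∑ g, χ g * ψ g⁻¹

theorem card_ne_zero_complex : (Nat.card G : ℂ) ≠ 0 := by
  exact_mod_cast Nat.card_pos.ne'

/-- The value is the dimension of a space of intertwining maps. -/
theorem IsChar.exists_cip_eq_natCast {χ ψ : G → ℂ} (h : IsChar χ) (h' : IsChar ψ) :
    ∃ n : ℕ, cip χ ψ = n := by
  obtain ⟨d, ρ, rfl⟩ := h
  obtain ⟨e, σ, rfl⟩ := h'
  let _ := invertibleOfNonzero (card_ne_zero_complex (G := G))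
  exact ⟨_, Representation.card_inv_mul_sum_char_mul_char_eq_finrank σ ρ⟩

open Classical in
-- Schur orthogonality distinguishes representations up to equivalence. Two inequivalent ones cannot
-- share a character, since that character would have norm both `0` and `1`.
theorem IsIrrChar.cip_eq {χ ψ : G → ℂ} (h : IsIrrChar χ) (h' : IsIrrChar ψ) :
    cip χ ψ = if χ = ψ then 1 else 0 := by
  obtain ⟨d, ρ, hρ, rfl⟩ := h
  obtain ⟨e, σ, hσ, rfl⟩ := h'
  let _ := invertibleOfNonzero (card_ne_zero_complex (G := G))
  have key := Representation.char_orthonormal ρ σ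
  rw [cip, key]
  by_cases hc : Nonempty (σ.Equiv ρ)
  · obtain ⟨e⟩ := id hc
    rw [if_pos hc, if_pos (Representation.char_iso e).symm]
  · rw [if_neg hc, if_neg]
    intro heq
    have key' := Representation.char_orthonormal ρ ρ
    rw [heq] at key key'
    rw [if_neg hc] at key
    rw [key, if_pos ⟨Representation.Equiv.refl ρ⟩] at key'
    exact zero_ne_one key'

theorem IsIrrChar.cip_self {χ : G → ℂ} (h : IsIrrChar χ) : cip χ χ = 1 := by
  rw [h.cip_eq h, if_pos rfl]

theorem IsIrrChar.eq_of_cip_ne_zero {χ ψ : G → ℂ} (h : IsIrrChar χ) (h' : IsIrrChar ψ)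
    (hc : cip χ ψ ≠ 0) : χ = ψ := by
  rw [h.cip_eq h'] at hc
  by_contra hne
  exact hc (if_neg hne)

/-- Irreducible representations with the same character are equivalent. -/
theorem nonempty_equiv_of_character_eq {V W : Type*} [AddCommGroup V] [Module ℂ V]
    [FiniteDimensional ℂ V] [AddCommGroup W] [Module ℂ W] [FiniteDimensional ℂ W]
    (ρ : Representation ℂ G V) (σ : Representation ℂ G W) [ρ.IsIrreducible] [σ.IsIrreducible]
    (h : ρ.character = σ.character) : Nonempty (ρ.Equiv σ) := by
  classical
  let _ := invertibleOfNonzero (card_ne_zero_complex (G := G))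
  have key := Representation.char_orthonormal σ ρ
  have key' := Representation.char_orthonormal σ σ
  rw [← h, if_pos ⟨Representation.Equiv.refl σ⟩] at key'
  by_contra hc
  rw [← h, if_neg hc, key'] at key
  exact one_ne_zero key

/-- By Maschke's theorem a proper nonzero invariant subspace has an invariant complement, and both
summands have smaller dimension. The space is quantified inside the induction because it is replaced
by these subspaces. -/
theorem exists_sum_irr_of_finrank (m : ℕ) : ∀ {V : Type} [AddCommGroup V] [Module ℂ V]
    [FiniteDimensional ℂ V] (ρ : Representation ℂ G V), finrank ℂ V = m →
    ∃ (n : ℕ) (ψ : Fin n → Irr G), ρ.character = fun g => ∑ i, (ψ i).1 g := by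
  induction m using Nat.strong_induction_on with
  | _ m ih =>
    intro V _ _ _ ρ hm
    by_cases hρ : ρ.IsIrreducible
    · exact ⟨1, fun _ => ⟨_, isIrrChar_character ρ hρ⟩, by simp⟩
    by_cases h0 : m = 0
    · have hV : Subsingleton V := finrank_zero_iff.mp (hm.trans h0)
      refine ⟨0, Fin.elim0, funext fun g => ?_⟩
      have : ρ g = 0 := LinearMap.ext fun _ => Subsingleton.elim _ _
      simp [Representation.character, this]
    have hbt : (⊥ : Subrepresentation ρ) ≠ ⊤ := by
      intro h
      have h' : (⊥ : Submodule ℂ V) = ⊤ := congrArg Subrepresentation.toSubmodule h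
      have := finrank_bot ℂ V
      rw [h', finrank_top] at this
      omega
    obtain ⟨U, hU⟩ : ∃ U : Subrepresentation ρ, U ≠ ⊥ ∧ U ≠ ⊤ := by
      by_contra hcon
      push Not at hcon
      exact hρ { toNontrivial := ⟨⟨_, _, hbt⟩⟩
                 eq_bot_or_eq_top := fun U => or_iff_not_imp_left.mpr (hcon U) }
    have : NeZero (Nat.card G : ℂ) := ⟨card_ne_zero_complex⟩
    have hss : ρ.IsSemisimpleRepresentation := inferInstance
    obtain ⟨W, hW⟩ := hss.exists_isCompl U
    have hc : IsCompl U.toSubmodule W.toSubmodule := by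
      constructor
      · rw [disjoint_iff]
        exact congrArg Subrepresentation.toSubmodule (disjoint_iff.mp hW.1)
      · rw [codisjoint_iff]
        exact congrArg Subrepresentation.toSubmodule (codisjoint_iff.mp hW.2)
    have hsum := Submodule.finrank_add_eq_of_isCompl hc
    have hU0 : finrank ℂ U.toSubmodule ≠ 0 := fun h =>
      hU.1 (Subrepresentation.toSubmodule_injective (Submodule.finrank_eq_zero.mp h))
    have hUm : finrank ℂ U.toSubmodule ≠ finrank ℂ V := fun h =>
      hU.2 (Subrepresentation.toSubmodule_injective (Submodule.eq_top_of_finrank_eq h))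
    obtain ⟨n₁, ψ₁, h₁⟩ := ih _ (by omega) U.toRepresentation rfl
    obtain ⟨n₂, ψ₂, h₂⟩ := ih _ (by omega) W.toRepresentation rfl
    refine ⟨n₁ + n₂, Fin.append ψ₁ ψ₂, ?_⟩
    rw [character_eq_add_of_isCompl ρ U W hc, h₁, h₂]
    funext g
    simp [Fin.sum_univ_add]

/-- Every character is a sum of irreducible characters. -/
theorem IsChar.exists_sum_irr {χ : G → ℂ} (h : IsChar χ) :
    ∃ (n : ℕ) (ψ : Fin n → Irr G), χ = fun g => ∑ i, (ψ i).1 g := by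
  obtain ⟨d, ρ, rfl⟩ := h
  exact exists_sum_irr_of_finrank _ ρ rfl

theorem cip_add_left (χ ψ η : G → ℂ) : cip (χ + ψ) η = cip χ η + cip ψ η := by
  simp [cip, add_mul, Finset.sum_add_distrib, mul_add]

theorem cip_add_right (χ ψ η : G → ℂ) : cip χ (ψ + η) = cip χ ψ + cip χ η := by
  simp [cip, Finset.sum_add_distrib, mul_add]

theorem cip_sub_left (χ ψ η : G → ℂ) : cip (χ - ψ) η = cip χ η - cip ψ η := by
  simp [cip, sub_mul, Finset.sum_sub_distrib, mul_sub]

theorem cip_sub_right (χ ψ η : G → ℂ) : cip χ (ψ - η) = cip χ ψ - cip χ η := by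
  simp [cip, Finset.sum_sub_distrib, mul_sub]

theorem cip_comm (χ ψ : G → ℂ) : cip χ ψ = cip ψ χ := by
  unfold cip
  congr 1
  rw [← Equiv.sum_comp (Equiv.inv G)]
  exact Finset.sum_congr rfl fun g _ => by simp [mul_comm]

theorem cip_sum_left {ι : Type*} (s : Finset ι) (χ : ι → G → ℂ) (ψ : G → ℂ) :
    cip (fun g => ∑ i ∈ s, χ i g) ψ = ∑ i ∈ s, cip (χ i) ψ := by
  simp only [cip, Finset.sum_mul, ← Finset.mul_sum]
  rw [Finset.sum_comm]

theorem cip_sum_right {ι : Type*} (s : Finset ι) (χ : ι → G → ℂ) (ψ : G → ℂ) :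
    cip ψ (fun g => ∑ i ∈ s, χ i g) = ∑ i ∈ s, cip ψ (χ i) := by
  rw [cip_comm, cip_sum_left]
  exact Finset.sum_congr rfl fun i _ => cip_comm _ _

/-- A nonzero character has an irreducible constituent. -/
theorem IsChar.exists_constituent {χ : G → ℂ} (h : IsChar χ) (h0 : χ ≠ 0) :
    ∃ ψ : Irr G, cip χ ψ.1 ≠ 0 := by
  classical
  obtain ⟨n, ψ, rfl⟩ := h.exists_sum_irr
  cases n with
  | zero => exact absurd (funext fun g => by simp) h0
  | succ n =>
    refine ⟨ψ 0, ?_⟩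
    rw [cip_sum_left]
    have : ∀ i, cip (ψ i).1 (ψ 0).1 = if (ψ i).1 = (ψ 0).1 then 1 else 0 :=
      fun i => (ψ i).2.cip_eq (ψ 0).2
    simp only [this, Finset.sum_boole, ne_eq, Nat.cast_eq_zero, Finset.card_eq_zero]
    exact Finset.nonempty_iff_ne_empty.mp ⟨0, by simp⟩

open scoped ComplexOrder in
/-- The values of a character at inverse elements are complex conjugate. -/
theorem IsChar.apply_inv {χ : G → ℂ} (h : IsChar χ) (g : G) : χ g⁻¹ = star (χ g) := by
  classical
  obtain ⟨d, ρ, rfl⟩ := h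
  let M : G → Matrix (Fin d) (Fin d) ℂ := fun g => LinearMap.toMatrix' (ρ g)
  have hM : ∀ a b, M (a * b) = M a * M b := fun a b => by
    simp [M, LinearMap.toMatrix'_mul]
  have hM1 : M 1 = 1 := by simp [M]
  have htr : ∀ a, ρ.character a = (M a).trace := fun a => by
    rw [Representation.character, LinearMap.trace_eq_matrix_trace ℂ (Pi.basisFun ℂ (Fin d))]
    rfl
  -- The Gram matrix of an averaged Hermitian form. It is positive definite, as its term at `1` is
  -- the identity, and invariant under `M g`; hence `M g⁻¹` is similar to the conjugate transpose of
  -- `M g`, and the traces are conjugate.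
  let H := ∑ a, (M a).conjTranspose * M a
  have hH : H.PosDef := by
    have h1 : H = (M 1).conjTranspose * M 1 +
        ∑ a ∈ Finset.univ.erase 1, (M a).conjTranspose * M a := by
      rw [Finset.add_sum_erase Finset.univ (fun a => (M a).conjTranspose * M a)
        (Finset.mem_univ 1)]
    rw [h1, hM1]
    simp only [Matrix.conjTranspose_one, mul_one]
    refine Matrix.PosDef.one.add_posSemidef (Matrix.posSemidef_sum _ fun a _ =>
      Matrix.posSemidef_conjTranspose_mul_self _)
  have hinv : (M g).conjTranspose * H * M g = H := by
    simp only [H, Finset.mul_sum, Finset.sum_mul]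
    rw [← Equiv.sum_comp (Equiv.mulRight g) fun a => (M a).conjTranspose * M a]
    refine Finset.sum_congr rfl fun a _ => ?_
    simp [hM, Matrix.conjTranspose_mul, mul_assoc]
  have hunit : IsUnit H.det := (Matrix.isUnit_iff_isUnit_det _).mp hH.isUnit
  have hgg : M g * M g⁻¹ = 1 := by rw [← hM, mul_inv_cancel, hM1]
  have h2 : M g⁻¹ = H⁻¹ * ((M g).conjTranspose * H) := by
    have : H * M g⁻¹ = (M g).conjTranspose * H := by
      conv_lhs => rw [← hinv]
      rw [mul_assoc, mul_assoc, hgg, mul_one]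
    rw [← this, Matrix.nonsing_inv_mul_cancel_left _ _ hunit]
  rw [htr, htr, h2, Matrix.trace_mul_comm, mul_assoc, Matrix.mul_nonsing_inv _ hunit, mul_one,
    Matrix.trace_conjTranspose]

/-- The symmetry `hf` turns the bilinear form into `|G|⁻¹ ∑ |f g|²`. -/
theorem eq_zero_of_cip_self_eq_zero {f : G → ℂ} (hf : ∀ g, f g⁻¹ = star (f g))
    (h : cip f f = 0) : f = 0 := by
  unfold cip at h
  rw [mul_eq_zero, or_iff_right (inv_ne_zero card_ne_zero_complex)] at h
  have h' : ∑ g, Complex.normSq (f g) = 0 := by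
    have : ((∑ g, Complex.normSq (f g) : ℝ) : ℂ) = 0 := by
      rw [← h]
      push_cast
      refine Finset.sum_congr rfl fun g _ => ?_
      rw [hf]
      exact (Complex.mul_conj _).symm
    exact_mod_cast this
  rw [Finset.sum_eq_zero_iff_of_nonneg fun g _ => Complex.normSq_nonneg _] at h'
  exact funext fun g => Complex.normSq_eq_zero.mp (h' g (Finset.mem_univ g))

theorem cip_self_nonneg {f : G → ℂ} (hf : ∀ g, f g⁻¹ = star (f g)) : 0 ≤ (cip f f).re := by
  have : cip f f = (((Nat.card G : ℝ)⁻¹ * ∑ g, Complex.normSq (f g) : ℝ) : ℂ) := by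
    unfold cip
    push_cast
    congr 1
    refine Finset.sum_congr rfl fun g _ => ?_
    rw [hf]
    exact (Complex.mul_conj _)
  rw [this, Complex.ofReal_re]
  exact mul_nonneg (by positivity) (Finset.sum_nonneg fun g _ => Complex.normSq_nonneg _)

/-- An irreducible character agrees with every function of norm one in which it occurs. -/
theorem IsIrrChar.eq_of_cip_eq_natCast {χ f : G → ℂ} (h : IsIrrChar χ)
    (hf : ∀ g, f g⁻¹ = star (f g)) (hff : cip f f = 1) {n : ℕ} (hn : n ≠ 0)
    (hχf : cip χ f = n) : χ = f := by
  have hsub : ∀ g, (χ - f) g⁻¹ = star ((χ - f) g) := fun g => by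
    simp [h.isChar.apply_inv, hf]
  -- This norm is nonnegative, which forces `n = 1`; it is then zero, so `χ = f`. Since `f` need not
  -- be a character, the argument applies to an induced function known only through its values.
  have hc : cip (χ - f) (χ - f) = 2 - 2 * n := by
    rw [cip_sub_left, cip_sub_right, cip_sub_right, h.cip_self, hff, cip_comm f χ, hχf]
    ring
  have hnn := cip_self_nonneg hsub
  have hre : (2 - 2 * n : ℂ).re = 2 - 2 * (n : ℝ) := by
    have : (2 - 2 * n : ℂ) = ((2 - 2 * (n : ℝ) : ℝ) : ℂ) := by push_cast; rfl
    rw [this, Complex.ofReal_re]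
  rw [hc, hre] at hnn
  have hn1 : n = 1 := by
    have : (n : ℝ) ≤ 1 := by linarith
    have : n ≤ 1 := by exact_mod_cast this
    omega
  have h0 : cip (χ - f) (χ - f) = 0 := by rw [hc, hn1]; norm_num
  exact sub_eq_zero.mp (eq_zero_of_cip_self_eq_zero hsub h0)

/-- A character whose pullback along a homomorphism has norm one is irreducible. -/
theorem IsChar.isIrrChar_of_cip_comp {H : Type*} [Group H] [Fintype H] (f : H →* G) {χ : G → ℂ}
    (h : IsChar χ) (hc : cip (χ ∘ f) (χ ∘ f) = 1) : IsIrrChar χ := by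
  obtain ⟨n, ψ, rfl⟩ := h.exists_sum_irr
  cases n with
  | zero =>
    exfalso
    have h0 : (fun g : G => ∑ i : Fin 0, (ψ i).1 g) ∘ f = 0 := by funext g; simp
    rw [h0] at hc
    simp [cip] at hc
  | succ n =>
    set A := (ψ 0).1 with hA
    set B : G → ℂ := fun g => ∑ i : Fin n, (ψ i.succ).1 g with hB
    have hB' : IsChar B := isChar_sum _ fun i => (ψ i.succ).2.isChar
    have hA' : IsIrrChar A := (ψ 0).2
    have hAB : (fun g : G => ∑ i : Fin (n + 1), (ψ i).1 g) = A + B := by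
      funext g; simp [Fin.sum_univ_succ, hA, hB]
    rw [hAB] at hc ⊢
    have hcomp : (A + B) ∘ f = A ∘ f + B ∘ f := rfl
    have cA := hA'.isChar.comp_hom f
    have cB := hB'.comp_hom f
    rw [hcomp, cip_add_left, cip_add_right, cip_add_right] at hc
    obtain ⟨a, ha⟩ := cA.exists_cip_eq_natCast cA
    obtain ⟨b, hb⟩ := cA.exists_cip_eq_natCast cB
    obtain ⟨c, hc'⟩ := cB.exists_cip_eq_natCast cA
    obtain ⟨d, hd⟩ := cB.exists_cip_eq_natCast cB
    rw [ha, hb, hc', hd] at hc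
    have hsum : a + b + (c + d) = 1 := by exact_mod_cast hc
    -- The pullback of `A` does not vanish at `1`, so `a` is positive. Four natural numbers with sum
    -- `1` then leave `d = 0`: the pullback of the remainder `B` is zero, and `B` has degree `0`.
    have ha0 : a ≠ 0 := by
      rintro rfl
      have := eq_zero_of_cip_self_eq_zero cA.apply_inv (by simpa using ha)
      exact hA'.apply_one_ne_zero (by simpa using congrFun this 1)
    have hd0 : d = 0 := by omega
    have hBf := eq_zero_of_cip_self_eq_zero cB.apply_inv (by simpa [hd0] using hd)
    have hB0 : B = 0 := hB'.eq_zero_of_apply_one (by simpa using congrFun hBf 1)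
    rw [hB0, add_zero]
    exact hA'

end CharacterTheory

/-! ### Irreducible characters of direct products. -/

section DirectProducts

open Module

/-- This is the regular representation: left translation by `g ≠ 1` fixes no element of the group,
so its trace vanishes. -/
theorem exists_sum_irr_eq_regular (G : Type*) [Group G] [Finite G] :
    ∃ (n : ℕ) (ψ : Fin n → Irr G), ∀ g, ∑ i, (ψ i).1 g ≠ 0 ↔ g = 1 := by
  classical
  have := Fintype.ofFinite G
  let ρ : Representation ℂ G (G → ℂ) :=
    { toFun := fun g => LinearMap.funLeft ℂ ℂ fun x => g⁻¹ * x
      map_one' := by ext; simp [LinearMap.funLeft_apply]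
      map_mul' := fun a b => by ext; simp [LinearMap.funLeft_apply, mul_assoc] }
  obtain ⟨n, ψ, h⟩ := (isChar_character ρ).exists_sum_irr
  refine ⟨n, ψ, fun g => ?_⟩
  rw [← congrFun h g, Representation.character,
    LinearMap.trace_eq_matrix_trace ℂ (Pi.basisFun ℂ G), Matrix.trace]
  have : ∀ x, (LinearMap.toMatrix (Pi.basisFun ℂ G) (Pi.basisFun ℂ G) (ρ g)).diag x =
      if g = 1 then 1 else 0 := fun x => by
    simp [ρ, LinearMap.funLeft_apply, Pi.single_apply]
  simp only [this]
  simp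

variable {ι : Type*} [Fintype ι] {G : ι → Type*} [∀ i, Group (G i)]

/-- The product `(x_i) ↦ ∏ χ_i(x_i)` of functions on the factors of a direct product. -/
def piProd (χ : ∀ i, G i → ℂ) (x : ∀ i, G i) : ℂ := ∏ i, χ i (x i)

theorem isChar_piProd {χ : ∀ i, G i → ℂ} (h : ∀ i, IsChar (χ i)) : IsChar (piProd χ) :=
  isChar_prod Finset.univ fun i => (h i).comp_hom (Pi.evalMonoidHom G i)

variable [DecidableEq ι] [∀ i, Fintype (G i)]

theorem cip_piProd (χ ψ : ∀ i, G i → ℂ) :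
    cip (piProd χ) (piProd ψ) = ∏ i, cip (χ i) (ψ i) := by
  simp only [cip, piProd, Nat.card_pi, Nat.cast_prod, Pi.inv_apply, ← Finset.prod_mul_distrib]
  rw [Finset.prod_mul_distrib, Finset.prod_inv_distrib, Finset.prod_univ_sum, Fintype.piFinset_univ]

theorem isIrrChar_piProd {χ : ∀ i, G i → ℂ} (h : ∀ i, IsIrrChar (χ i)) : IsIrrChar (piProd χ) := by
  refine (isChar_piProd fun i => (h i).isChar).isIrrChar_of_cip_comp (MonoidHom.id _) ?_
  change cip (piProd χ) (piProd χ) = 1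
  rw [cip_piProd]
  exact Finset.prod_eq_one fun i _ => (h i).cip_self

theorem piProd_injective {χ ψ : ∀ i, Irr (G i)}
    (h : piProd (fun i => (χ i).1) = piProd fun i => (ψ i).1) : χ = ψ := by
  have h1 : cip (piProd fun i => (χ i).1) (piProd fun i => (ψ i).1) ≠ 0 := by
    rw [← h, (isIrrChar_piProd fun i => (χ i).2).cip_self]
    exact one_ne_zero
  rw [cip_piProd, Finset.prod_ne_zero_iff] at h1
  exact funext fun i =>
    Subtype.ext ((χ i).2.eq_of_cip_ne_zero (ψ i).2 (h1 i (Finset.mem_univ i)))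

/-- Every irreducible character of a direct product is a product of irreducible characters. -/
theorem IsIrrChar.exists_eq_piProd {χ : (∀ i, G i) → ℂ} (h : IsIrrChar χ) :
    ∃ ψ : ∀ i, Irr (G i), χ = piProd fun i => (ψ i).1 := by
  choose n ψ hψ using fun i => exists_sum_irr_eq_regular (G i)
  by_contra hcon
  push Not at hcon
  -- The product of the regular characters of the factors is a sum of products of irreducible
  -- characters, so it is orthogonal to `χ` if `χ` is not such a product. But it is supported at
  -- `1`, where neither it nor `χ` vanishes.
  have h0 : cip χ (piProd fun i g => ∑ k, (ψ i k).1 g) = 0 := by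
    have : (piProd fun i g => ∑ k, (ψ i k).1 g) =
        fun x => ∑ k : ∀ i, Fin (n i), piProd (fun i => (ψ i (k i)).1) x := by
      funext x
      simp only [piProd]
      rw [Finset.prod_univ_sum, Fintype.piFinset_univ]
    rw [this, cip_sum_right]
    refine Finset.sum_eq_zero fun k _ => ?_
    by_contra hne
    exact hcon (fun i => ψ i (k i))
      (h.eq_of_cip_ne_zero (isIrrChar_piProd fun i => (ψ i (k i)).2) hne)
  unfold cip at h0
  rw [mul_eq_zero, or_iff_right (inv_ne_zero card_ne_zero_complex),
    Finset.sum_eq_single 1] at h0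
  · rw [mul_eq_zero, or_iff_right h.apply_one_ne_zero] at h0
    refine absurd h0 (Finset.prod_ne_zero_iff.mpr fun i _ => ?_)
    simpa using (hψ i 1).mpr rfl
  · intro x _ hx
    obtain ⟨i, hi⟩ := Function.ne_iff.mp hx
    rw [mul_eq_zero]
    right
    refine Finset.prod_eq_zero (Finset.mem_univ i) ?_
    by_contra hne
    exact hi (inv_eq_one.mp ((hψ i _).mp hne))
  · simp

end DirectProducts

/-! ### Traces on tensor powers. -/

section TensorPower

open Module

/-- The trace of a tensor product of endomorphisms is the product of the traces. -/
theorem trace_piTensorProduct_map {ι V : Type*} [Fintype ι] [AddCommGroup V]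
    [Module ℂ V] [FiniteDimensional ℂ V] (f : ι → V →ₗ[ℂ] V) :
    LinearMap.trace ℂ _ (PiTensorProduct.map f) = ∏ i, LinearMap.trace ℂ V (f i) := by
  classical
  let b := finBasis ℂ V
  rw [LinearMap.trace_eq_matrix_trace ℂ (Basis.piTensorProduct fun _ : ι => b), Matrix.trace]
  simp only [LinearMap.trace_eq_matrix_trace ℂ b, Matrix.trace, Finset.prod_univ_sum,
    Fintype.piFinset_univ]
  refine Finset.sum_congr rfl fun x _ => ?_
  simp [LinearMap.toMatrix_apply, PiTensorProduct.map_tprod]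

variable {G V : Type*} [Group G] [AddCommGroup V] [Module ℂ V] {p : ℕ}

theorem wreathTensor_tprod (ρ : Representation ℂ G V) (f : Fin p → G) (s : Perm (Fin p))
    (v : Fin p → V) :
    wreathTensor ρ f s (PiTensorProduct.tprod ℂ v) =
      PiTensorProduct.tprod ℂ fun i => ρ (f i) (v (s⁻¹ i)) := by
  simp [wreathTensor, PiTensorProduct.map_tprod, Perm.inv_def]

theorem wreathTensor_mul (ρ : Representation ℂ G V) (f g : Fin p → G) (s t : Perm (Fin p)) :
    wreathTensor ρ f s * wreathTensor ρ g t =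
      wreathTensor ρ (fun i => f i * g (s⁻¹ i)) (s * t) := by
  refine PiTensorProduct.ext (MultilinearMap.ext fun v => ?_)
  simp [wreathTensor_tprod]

theorem wreathTensor_one (ρ : Representation ℂ G V) :
    wreathTensor ρ (1 : Fin p → G) 1 = 1 := by
  refine PiTensorProduct.ext (MultilinearMap.ext fun v => ?_)
  simp [wreathTensor_tprod]

theorem trace_wreathTensor_base [FiniteDimensional ℂ V] (ρ : Representation ℂ G V)
    (f : Fin p → G) :
    LinearMap.trace ℂ _ (wreathTensor ρ f 1) = ∏ i, ρ.character (f i) := by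
  have : wreathTensor ρ f 1 = PiTensorProduct.map fun i => ρ (f i) := by
    refine PiTensorProduct.ext (MultilinearMap.ext fun v => ?_)
    simp [wreathTensor_tprod, PiTensorProduct.map_tprod]
  rw [this, trace_piTensorProduct_map]
  rfl

/-- `calX` is defined with a chosen representation affording `φ`; this makes its values independent
of that choice. -/
theorem trace_wreathTensor_equiv {W : Type*} [AddCommGroup W] [Module ℂ W]
    {ρ : Representation ℂ G V} {σ : Representation ℂ G W} (e : ρ.Equiv σ) (f : Fin p → G)
    (s : Perm (Fin p)) :
    LinearMap.trace ℂ _ (wreathTensor σ f s) = LinearMap.trace ℂ _ (wreathTensor ρ f s) := by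
  rw [← LinearMap.trace_conj' (wreathTensor ρ f s)
    (PiTensorProduct.congr fun _ => e.toLinearEquiv)]
  congr 1
  refine PiTensorProduct.ext (MultilinearMap.ext fun v => ?_)
  have h : ∀ g w, e (ρ g (e.symm w)) = σ g w := fun g w => by
    have := e.toIntertwiningMap.isIntertwining _ _ g (e.symm w)
    simpa using this
  simp [wreathTensor_tprod, LinearEquiv.conj_apply, PiTensorProduct.congr_tprod]
  exact congrArg _ (funext fun i => (h _ _).symm)

/-- Conjugation by a permutation of the tensor factors does not change the trace. -/
theorem trace_wreathTensor_conj (ρ : Representation ℂ G V) (f : Fin p → G)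
    (s m : Perm (Fin p)) :
    LinearMap.trace ℂ _ (wreathTensor ρ (fun i => f (m i)) (m⁻¹ * s * m)) =
      LinearMap.trace ℂ _ (wreathTensor ρ f s) := by
  have h : wreathTensor ρ (fun i => f (m i)) (m⁻¹ * s * m) =
      (wreathTensor ρ 1 m⁻¹ * wreathTensor ρ f s) * wreathTensor ρ 1 m := by
    rw [wreathTensor_mul, wreathTensor_mul]
    simp
  rw [h, LinearMap.trace_mul_comm, ← mul_assoc, wreathTensor_mul]
  have : wreathTensor ρ (fun i => (1 : Fin p → G) i * (1 : Fin p → G) (m⁻¹ i)) (m * m⁻¹) = 1 := by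
    rw [mul_inv_cancel, ← wreathTensor_one ρ]
    congr 1
    funext i
    simp
  rw [this, one_mul]

end TensorPower

/-! ### The structure of `P_{p^(k+1)} = P_{p^k} ≀ P_p` -/

theorem mem_normalizer_of_conj {G : Type*} [Group G] {H : Subgroup G} {h : G}
    (h₁ : ∀ x ∈ H, h * x * h⁻¹ ∈ H) (h₂ : ∀ x ∈ H, h⁻¹ * x * h ∈ H) :
    h ∈ Subgroup.normalizer (H : Set G) := by
  refine Subgroup.mem_normalizer_iff.mpr fun x => ⟨h₁ x, fun hx => ?_⟩
  simpa [mul_assoc] using h₂ _ hx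

/-! ### The group `P_p` as translations modulo `p`, its linear characters, and multiplication by
units. -/

section Cyclic

theorem val_finRotate_pow {p : ℕ} (m : ℕ) (i : Fin p) :
    ((finRotate p ^ m) i : ℕ) = (i + m) % p := by
  induction m with
  | zero => simp [Nat.mod_eq_of_lt i.isLt]
  | succ m ih =>
    rw [pow_succ', Perm.mul_apply, finRotate_apply, Fin.val_add, ih, Nat.add_mod,
      Nat.mod_mod]
    simp [add_assoc]

variable {p : ℕ} [Fact p.Prime]

theorem mem_cyc_iff {s : Perm (Fin p)} : s ∈ cyc p ↔ ∃ c, ∀ i, s i = i + c := by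
  constructor
  · intro hs
    obtain ⟨m, rfl⟩ := mem_powers_iff_mem_zpowers.mpr hs
    refine ⟨⟨m % p, Nat.mod_lt _ (NeZero.pos p)⟩, fun i => Fin.ext ?_⟩
    simp [val_finRotate_pow, Fin.val_add]
  · rintro ⟨c, hc⟩
    have : s = finRotate p ^ (c : ℕ) := by
      ext i
      rw [val_finRotate_pow, hc, Fin.val_add]
    rw [this]
    exact pow_mem (Subgroup.mem_zpowers _) _

theorem cyc_apply (s : cyc p) (i : Fin p) : (s : Perm (Fin p)) i = i + (s : Perm (Fin p)) 0 := by
  obtain ⟨c, hc⟩ := mem_cyc_iff.mp s.2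
  simp [hc]

/-- An element of `P_p` is determined by the image of the first point. -/
def cycEquiv : cyc p ≃ Fin p where
  toFun s := (s : Perm (Fin p)) 0
  invFun c := ⟨Equiv.addRight c, mem_cyc_iff.mpr ⟨c, fun _ => rfl⟩⟩
  left_inv s := by
    ext i
    simp [cyc_apply s i]
  right_inv c := by simp

theorem cyc_ext {s t : cyc p} (h : (s : Perm (Fin p)) 0 = (t : Perm (Fin p)) 0) : s = t :=
  cycEquiv.injective h

theorem cyc_mul_comm (s t : cyc p) : s * t = t * s := by
  apply cyc_ext
  simp only [Subgroup.coe_mul, Perm.mul_apply]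
  rw [cyc_apply s, cyc_apply t ((s : Perm (Fin p)) 0), add_comm]

theorem nat_card_cyc : Nat.card (cyc p) = p := by
  rw [Nat.card_congr cycEquiv, Nat.card_fin]

/-- A function on `Fin p` which is invariant under a nontrivial rotation is constant. -/
theorem eq_of_comp_cyc_eq {α : Type*} {f : Fin p → α} {s : cyc p} (hs : s ≠ 1)
    (h : ∀ i, f ((s : Perm (Fin p)) i) = f i) (i j : Fin p) : f i = f j := by
  -- In a group of prime order every nontrivial element generates, so invariance under `s` is
  -- invariance under all rotations.
  have horder : ∀ t : cyc p, t ∈ Subgroup.zpowers s := by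
    intro t
    exact mem_zpowers_of_prime_card (p := p) nat_card_cyc hs
  have hz : ∀ t : cyc p, ∀ i, f ((t : Perm (Fin p)) i) = f i := by
    intro t
    let H : Subgroup (cyc p) :=
      { carrier := {t | ∀ i, f ((t : Perm (Fin p)) i) = f i}
        mul_mem' := fun {a b} ha hb i => (ha ((b : Perm (Fin p)) i)).trans (hb i)
        one_mem' := fun i => rfl
        inv_mem' := fun {a} ha i => by simpa using (ha ((a⁻¹ : Perm (Fin p)) i)).symm }
    exact (Subgroup.zpowers_le (H := H)).mpr h (horder t)
  have := hz (cycEquiv.symm (j - i)) i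
  rw [cyc_apply] at this
  simpa [cycEquiv] using this.symm

theorem phi_mul (ε : Fin p) (s t : cyc p) : phi ε (s * t) = phi ε s * phi ε t := by
  have hω : (Complex.exp (2 * Real.pi * Complex.I / p) ^ (ε : ℕ)) ^ p = 1 := by
    rw [← pow_mul, mul_comm (ε : ℕ), pow_mul, (Complex.isPrimitiveRoot_exp p (NeZero.ne p)).pow_eq_one,
      one_pow]
  unfold phi
  rw [← pow_add, ← mul_add, pow_mul, pow_mul, Subgroup.coe_mul, Perm.mul_apply, cyc_apply,
    Fin.val_add, ← pow_eq_pow_mod _ hω, add_comm]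

theorem phi_one (ε : Fin p) : phi ε (1 : cyc p) = 1 := by simp [phi]

/-- The power of `exp(2πi/p)` attached to a nontrivial rotation is a primitive root of unity. -/
theorem isPrimitiveRoot_exp_pow {s : cyc p} (hs : s ≠ 1) :
    IsPrimitiveRoot (Complex.exp (2 * Real.pi * Complex.I / p) ^
      (((s : Perm (Fin p)) 0 : Fin p) : ℕ)) p := by
  have h0 : (((s : Perm (Fin p)) 0 : Fin p) : ℕ) ≠ 0 := by
    intro h
    refine hs (cyc_ext ?_)
    simpa using Fin.ext h
  have hlt := ((s : Perm (Fin p)) 0).isLt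
  have hcop : Nat.Coprime (((s : Perm (Fin p)) 0 : Fin p) : ℕ) p :=
    Nat.Coprime.symm ((Nat.Prime.coprime_iff_not_dvd Fact.out).mpr
      (Nat.not_dvd_of_pos_of_lt (Nat.pos_of_ne_zero h0) hlt))
  exact (Complex.isPrimitiveRoot_exp p (NeZero.ne p)).pow_of_coprime _ hcop

theorem sum_phi {s : cyc p} (hs : s ≠ 1) : ∑ ε : Fin p, phi ε s = 0 := by
  have := (isPrimitiveRoot_exp_pow hs).geom_sum_eq_zero (Fact.out : p.Prime).one_lt
  rw [← this, Finset.sum_range]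
  refine Finset.sum_congr rfl fun ε _ => ?_
  rw [phi, mul_comm (ε : ℕ), pow_mul]

theorem phi_injective {ε ε' : Fin p} {s : cyc p} (hs : s ≠ 1) (h : phi ε s = phi ε' s) :
    ε = ε' := by
  unfold phi at h
  rw [mul_comm (ε : ℕ), pow_mul, mul_comm (ε' : ℕ), pow_mul] at h
  exact Fin.ext ((isPrimitiveRoot_exp_pow hs).pow_inj ε.isLt ε'.isLt h)

theorem residue_apply (i : Fin p) : residue p i = ((i : ℕ) : ZMod p) + 1 := by
  have h : (ZMod.finEquiv p) i = ((i : ℕ) : ZMod p) := by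
    obtain ⟨n, rfl⟩ : ∃ n, p = n + 1 := ⟨p - 1, by have := (Fact.out : p.Prime).pos; omega⟩
    exact (ZMod.natCast_zmod_val (n := n + 1) i).symm
  simp [residue, h]

theorem residue_mulPerm (u : (ZMod p)ˣ) (i : Fin p) :
    residue p (mulPerm u i) = u * residue p i := by
  simp [mulPerm, Equiv.permCongr_apply]

theorem mulPerm_inv (u : (ZMod p)ˣ) : (mulPerm u)⁻¹ = mulPerm (p := p) u⁻¹ := by
  refine inv_eq_of_mul_eq_one_left (Equiv.ext fun i => (residue p).injective ?_)
  rw [Perm.mul_apply, residue_mulPerm, residue_mulPerm, Units.inv_mul_cancel_left, Perm.one_apply]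

theorem residue_cyc (s : cyc p) (i : Fin p) :
    residue p ((s : Perm (Fin p)) i) =
      residue p i + (((s : Perm (Fin p)) 0 : Fin p) : ℕ) := by
  rw [residue_apply, residue_apply, cyc_apply, Fin.val_add, ZMod.natCast_mod]
  push_cast
  ring

theorem mem_cyc_of_residue {s : Perm (Fin p)} (c : ZMod p)
    (h : ∀ i, residue p (s i) = residue p i + c) : s ∈ cyc p := by
  refine mem_cyc_iff.mpr ⟨(ZMod.finEquiv p).symm c, fun i => (residue p).injective ?_⟩
  rw [h]
  simp [residue, add_right_comm]

/-- In residues: multiply by `u`, add `c`, divide by `u`; the net effect is adding `u⁻¹ c`. -/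
theorem mulPerm_conj_apply (u : (ZMod p)ˣ) (s : cyc p) (i : Fin p) :
    residue p (((mulPerm u)⁻¹ * (s : Perm (Fin p)) * mulPerm u) i) = residue p i +
      ((u⁻¹ : (ZMod p)ˣ) : ZMod p) * (((s : Perm (Fin p)) 0 : Fin p) : ℕ) := by
  rw [mulPerm_inv, Perm.mul_apply, Perm.mul_apply, residue_mulPerm, residue_cyc, residue_mulPerm,
    mul_add, Units.inv_mul_cancel_left]

theorem mulPerm_mem_normalizer (u : (ZMod p)ˣ) :
    mulPerm u ∈ Subgroup.normalizer (cyc p : Set (Perm (Fin p))) := by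
  have key : ∀ v : (ZMod p)ˣ, ∀ s ∈ cyc p, (mulPerm v)⁻¹ * s * mulPerm v ∈ cyc p :=
    fun v s hs => mem_cyc_of_residue _ (mulPerm_conj_apply v ⟨s, hs⟩)
  refine mem_normalizer_of_conj (fun s hs => ?_) (key u)
  have := key u⁻¹ s hs
  rwa [← mulPerm_inv, inv_inv] at this

/-- The effect of `τ` on the labels `0, …, p - 1`. -/
def tauFin (u : (ZMod p)ˣ) (ε : Fin p) : Fin p :=
  ⟨(((u⁻¹ : (ZMod p)ˣ) : ZMod p) * ((ε : ℕ) : ZMod p)).val, ZMod.val_lt _⟩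

theorem tauLabel_castSucc (u : (ZMod p)ˣ) (ε : Fin p) :
    tauLabel u ε.castSucc = (tauFin u ε).castSucc := by
  rw [tauLabel, if_neg (Fin.castSucc_lt_last ε).ne]
  rfl

/-- Only exponents modulo `p` matter, and the factor `u⁻¹` by which conjugation scales the rotation
can be moved onto `ε`. -/
theorem phi_conj_mulPerm (u : (ZMod p)ˣ) (ε : Fin p) (s : cyc p) :
    phi ε (conjEquiv (mulPerm_mem_normalizer u) s) = phi (tauFin u ε) s := by
  have hω := (Complex.isPrimitiveRoot_exp p (NeZero.ne p)).pow_eq_one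
  unfold phi
  rw [pow_eq_pow_mod _ hω, pow_eq_pow_mod (_ * _) hω]
  congr 1
  change _ ≡ _ [MOD p]
  rw [← ZMod.natCast_eq_natCast_iff]
  have h := mulPerm_conj_apply u s 0
  rw [residue_apply, residue_apply] at h
  have h' : (((((conjEquiv (mulPerm_mem_normalizer u) s : cyc p) : Perm (Fin p)) 0 : Fin p) : ℕ) :
      ZMod p) = ((u⁻¹ : (ZMod p)ˣ) : ZMod p) * (((s : Perm (Fin p)) 0 : Fin p) : ℕ) := by
    rw [Fin.val_zero, Nat.cast_zero, zero_add, add_comm, add_right_inj] at h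
    exact h
  rw [Nat.cast_mul, Nat.cast_mul, h']
  simp only [tauFin, ZMod.natCast_val, ZMod.cast_id', id_eq]
  ring

end Cyclic

/-! ### Elements `(f; s)` of the wreath product and elements normalizing it. -/

section Wreath

variable {p : ℕ}

theorem wr_apply {k : ℕ} (f : Fin p → Perm (Fin (p ^ k))) (s : Perm (Fin p)) (i : Fin p)
    (r : Fin (p ^ k)) :
    wr f s (blockEquiv p k (i, r)) = blockEquiv p k (s i, f (s i) r) := by
  simp [wr, Equiv.permCongr_apply, Equiv.prodShear]

theorem wr_inv {k : ℕ} (f : Fin p → Perm (Fin (p ^ k))) (s : Perm (Fin p)) :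
    (wr f s)⁻¹ = wr (fun i => (f (s i))⁻¹) s⁻¹ := by
  rw [inv_eq_iff_mul_eq_one, wr_mul]
  simpa using! wr_one

/-- Conjugation of elements of a wreath product by an element of the form `(h, …, h; m)`. -/
theorem wr_conj {k : ℕ} (f : Fin p → Perm (Fin (p ^ k))) (s m : Perm (Fin p))
    (h : Perm (Fin (p ^ k))) :
    (wr (fun _ => h) m)⁻¹ * wr f s * wr (fun _ => h) m =
      wr (fun i => h⁻¹ * f (m i) * h) (m⁻¹ * s * m) := by
  rw [wr_inv, wr_mul, wr_mul]
  simp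

variable [Fact p.Prime] {k : ℕ}

theorem wr_injective {f g : Fin p → Perm (Fin (p ^ k))} {s t : Perm (Fin p)}
    (h : wr f s = wr g t) : f = g ∧ s = t := by
  have hp : 0 < p ^ k := Nat.pow_pos (NeZero.pos p)
  have key : ∀ i r, (s i, f (s i) r) = (t i, g (t i) r) := fun i r => by
    apply (blockEquiv p k).injective
    rw [← wr_apply, ← wr_apply, h]
  have hst : s = t := Equiv.ext fun i => congrArg Prod.fst (key i ⟨0, hp⟩)
  subst hst
  refine ⟨funext fun i => Equiv.ext fun r => ?_, rfl⟩
  simpa using congrArg Prod.snd (key (s⁻¹ i) r)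

theorem gen_mem {k j : ℕ} (h1 : 1 ≤ j) (h2 : j ≤ k) : gen p k j ∈ P p k :=
  Subgroup.subset_closure ⟨j, h1, h2, rfl⟩

theorem wr_top_mem {s : Perm (Fin p)} (hs : s ∈ cyc p) :
    wr (1 : Fin p → Perm (Fin (p ^ k))) s ∈ P p (k + 1) := by
  let F : Perm (Fin p) →* Perm (Fin (p ^ (k + 1))) :=
    { toFun := wr 1
      map_one' := wr_one
      map_mul' := fun s t => by rw [wr_mul]; congr 1 }
  have : cyc p ≤ (P p (k + 1)).comap F := by
    rw [cyc, Subgroup.zpowers_le]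
    have := gen_mem (p := p) (k := k + 1) (j := k + 1) (by omega) le_rfl
    simpa [gen] using! this
  exact this hs

/-- The generators below the top level act only in block `0`; conjugating by the rotation that takes
`i` to `0` carries them to block `i`. -/
theorem wr_single_mem (i : Fin p) {h : Perm (Fin (p ^ k))} (hh : h ∈ P p k) :
    wr (Pi.mulSingle i h) 1 ∈ P p (k + 1) := by
  have h0 : wr (Pi.mulSingle 0 h) 1 ∈ P p (k + 1) := by
    let F : Perm (Fin (p ^ k)) →* Perm (Fin (p ^ (k + 1))) :=
      { toFun := fun h => wr (Pi.mulSingle 0 h) 1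
        map_one' := by rw [Pi.mulSingle_one, wr_one]
        map_mul' := fun s t => by rw [wr_mul]; simp [Pi.mulSingle_mul]; rfl }
    have : P p k ≤ (P p (k + 1)).comap F := by
      refine (Subgroup.closure_le _).mpr ?_
      rintro _ ⟨j, h1, h2, rfl⟩
      have := gen_mem (p := p) (k := k + 1) (j := j) h1 (by omega)
      simpa [gen, show j ≠ k + 1 by omega] using! this
    exact this hh
  let s : cyc p := cycEquiv.symm (-i)
  have hs0 : (s : Perm (Fin p)) i = 0 := by simp [s, cycEquiv]
  have hs := wr_top_mem (k := k) s.2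
  have := mul_mem (mul_mem (inv_mem hs) h0) hs
  have e := wr_conj (Pi.mulSingle 0 h) 1 (s : Perm (Fin p)) 1
  rw [show (fun _ => 1 : Fin p → Perm (Fin (p ^ k))) = 1 from rfl] at e
  rw [e] at this
  convert this using 2
  · funext j
    by_cases hj : j = i
    · subst hj; simp [hs0]
    · have : (s : Perm (Fin p)) j ≠ 0 :=
        fun hc => hj ((s : Perm (Fin p)).injective (hc.trans hs0.symm))
      simp [Pi.mulSingle_eq_of_ne hj, Pi.mulSingle_eq_of_ne this]
  · simp

/-- Converse of `exists_wr`: together they identify `P_{p^(k+1)}` with the full wreath product. -/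
theorem wr_mem {f : Fin p → Perm (Fin (p ^ k))} {s : Perm (Fin p)} (hf : ∀ i, f i ∈ P p k)
    (hs : s ∈ cyc p) : wr f s ∈ P p (k + 1) := by
  have hb : wr f 1 ∈ P p (k + 1) := by
    let F : (Fin p → Perm (Fin (p ^ k))) →* Perm (Fin (p ^ (k + 1))) :=
      { toFun := fun f => wr f 1
        map_one' := wr_one
        map_mul' := fun s t => by rw [wr_mul]; simp; rfl }
    have : f ∈ (P p (k + 1)).comap F := by
      refine Subgroup.pi_mem_of_mulSingle_mem f fun i => wr_single_mem i (hf i)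
    exact this
  have := mul_mem hb (wr_top_mem (k := k) hs)
  rw [wr_mul] at this
  simpa using this

/-- The element `(f; s)` of `P_{p^k} ≀ P_p`. -/
def mkW (f : Fin p → P p k) (s : cyc p) : P p (k + 1) :=
  ⟨wr (fun i => (f i : Perm (Fin (p ^ k)))) s, wr_mem (fun i => (f i).2) s.2⟩

theorem coe_mkW (f : Fin p → P p k) (s : cyc p) :
    (mkW f s : Perm (Fin (p ^ (k + 1)))) = wr (fun i => (f i : Perm (Fin (p ^ k)))) s := rfl

theorem mkW_injective {f g : Fin p → P p k} {s t : cyc p} (h : mkW f s = mkW g t) :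
    f = g ∧ s = t := by
  have h' := congrArg Subtype.val h
  rw [coe_mkW, coe_mkW] at h'
  obtain ⟨h1, h2⟩ := wr_injective h'
  exact ⟨funext fun i => Subtype.ext (congrFun h1 i), Subtype.ext h2⟩

theorem mkW_base_top (x : P p (k + 1)) : mkW (base x) (top x) = x :=
  Subtype.ext (exists_wr x.2).choose_spec.choose_spec.symm

@[simp] theorem base_mkW (f : Fin p → P p k) (s : cyc p) : base (mkW f s) = f :=
  (mkW_injective (mkW_base_top (mkW f s))).1

@[simp] theorem top_mkW (f : Fin p → P p k) (s : cyc p) : top (mkW f s) = s :=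
  (mkW_injective (mkW_base_top (mkW f s))).2

theorem mkW_mul (f g : Fin p → P p k) (s t : cyc p) :
    mkW f s * mkW g t = mkW (fun i => f i * g ((s : Perm (Fin p))⁻¹ i)) (s * t) := by
  apply Subtype.ext
  simp only [Subgroup.coe_mul, coe_mkW, wr_mul]

theorem mkW_one : mkW (1 : Fin p → P p k) 1 = 1 := Subtype.ext wr_one

theorem mkW_inv (f : Fin p → P p k) (s : cyc p) :
    (mkW f s)⁻¹ = mkW (fun i => (f ((s : Perm (Fin p)) i))⁻¹) s⁻¹ := by
  apply Subtype.ext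
  simp only [Subgroup.coe_inv, coe_mkW, wr_inv]

/-- The bijection `(f, s) ↦ (f; s)`. -/
noncomputable def wreathEquiv (p k : ℕ) [Fact p.Prime] :
    (Fin p → P p k) × cyc p ≃ P p (k + 1) where
  toFun x := mkW x.1 x.2
  invFun x := (base x, top x)
  left_inv x := by simp
  right_inv x := mkW_base_top x

theorem nat_card_P_succ : Nat.card (P p (k + 1)) = Nat.card (Fin p → P p k) * p := by
  rw [← Nat.card_congr (wreathEquiv p k), Nat.card_prod, nat_card_cyc]

/-- The embedding of the base group. -/
def mkB (p k : ℕ) [Fact p.Prime] : (Fin p → P p k) →* P p (k + 1) where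
  toFun f := mkW f 1
  map_one' := mkW_one
  map_mul' f g := by rw [mkW_mul]; simp; rfl

theorem mkW_mem_baseGroup {f : Fin p → P p k} {s : cyc p} :
    mkW f s ∈ baseGroup (p := p) k ↔ s = 1 := by
  constructor
  · rintro ⟨g, hg⟩
    have hg' : wr (fun i => (g i : Perm (Fin (p ^ k)))) 1 =
        wr (fun i => (f i : Perm (Fin (p ^ k)))) s := hg
    exact (Subtype.ext (wr_injective hg').2).symm
  · rintro rfl
    exact ⟨f, rfl⟩

theorem nat_card_baseGroup : Nat.card (baseGroup (p := p) k) = Nat.card (Fin p → P p k) := by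
  refine (Nat.card_congr (Equiv.ofBijective
    (fun f => (⟨mkB p k f, mkW_mem_baseGroup.mpr rfl⟩ : baseGroup (p := p) k)) ⟨?_, ?_⟩)).symm
  · intro f g h
    exact (mkW_injective (congrArg Subtype.val h)).1
  · rintro ⟨x, hx⟩
    refine ⟨base x, Subtype.ext ?_⟩
    change mkW (base x) 1 = x
    rw [← mkW_base_top x, mkW_mem_baseGroup] at hx
    conv_rhs => rw [← mkW_base_top x, hx]

/-- An element `(h, …, h; m)` with `h` normalizing `P_{p^k}` and `m` normalizing `P_p`
normalizes `P_{p^(k+1)}`. -/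
theorem wr_mem_normalizer {h : Perm (Fin (p ^ k))} {m : Perm (Fin p)}
    (hh : h ∈ Subgroup.normalizer (P p k : Set (Perm (Fin (p ^ k)))))
    (hm : m ∈ Subgroup.normalizer (cyc p : Set (Perm (Fin p)))) :
    wr (fun _ => h) m ∈ Subgroup.normalizer (P p (k + 1) : Set (Perm (Fin (p ^ (k + 1))))) := by
  -- One inclusion is proved for all pairs `(h, m)`; the opposite one is its instance at the
  -- inverses.
  have key : ∀ {h : Perm (Fin (p ^ k))} {m : Perm (Fin p)},
      h ∈ Subgroup.normalizer (P p k : Set (Perm (Fin (p ^ k)))) →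
      m ∈ Subgroup.normalizer (cyc p : Set (Perm (Fin p))) → ∀ x ∈ P p (k + 1),
      (wr (fun _ => h) m)⁻¹ * x * wr (fun _ => h) m ∈ P p (k + 1) := by
    intro h m hh hm x hx
    obtain ⟨f, s, rfl⟩ := exists_wr hx
    rw [wr_conj]
    exact wr_mem (fun i => (conjEquiv hh (f (m i))).2) (conjEquiv hm s).2
  refine mem_normalizer_of_conj (fun x hx => ?_) (key hh hm)
  have := key (inv_mem hh) (inv_mem hm) x hx
  rwa [← wr_inv (fun _ => h) m, inv_inv] at this

theorem conjEquiv_mkW {h : Perm (Fin (p ^ k))} {m : Perm (Fin p)}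
    (hh : h ∈ Subgroup.normalizer (P p k : Set (Perm (Fin (p ^ k)))))
    (hm : m ∈ Subgroup.normalizer (cyc p : Set (Perm (Fin p))))
    (hw : wr (fun _ => h) m ∈ Subgroup.normalizer (P p (k + 1) : Set (Perm (Fin (p ^ (k + 1))))))
    (f : Fin p → P p k) (s : cyc p) :
    conjEquiv hw (mkW f s) = mkW (fun i => conjEquiv hh (f (m i))) (conjEquiv hm s) := by
  apply Subtype.ext
  simp only [conjEquiv, MulEquiv.coe_mk, Equiv.coe_fn_mk, coe_mkW, wr_conj]

theorem sigma_mem_normalizer (u : (ZMod p)ˣ) (k j : ℕ) :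
    sigma u k j ∈ Subgroup.normalizer (P p k : Set (Perm (Fin (p ^ k)))) := by
  induction k with
  | zero => exact one_mem _
  | succ k ih =>
    rw [sigma]
    split_ifs
    · exact wr_mem_normalizer (one_mem _) (mulPerm_mem_normalizer u)
    · exact wr_mem_normalizer ih (one_mem _)

end Wreath

/-! ### Irreducible characters of the wreath product -/

section WreathCharacters

variable {p : ℕ} [Fact p.Prime] {k : ℕ}

noncomputable instance fintypeP (p k : ℕ) [Fact p.Prime] : Fintype (P p k) := Fintype.ofFinite _

noncomputable instance fintypeCyc (p : ℕ) [Fact p.Prime] : Fintype (cyc p) := Fintype.ofFinite _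

theorem card_cyc_complex : (Fintype.card (cyc p) : ℂ) = p := by
  rw [Fintype.card_eq_nat_card, nat_card_cyc]

theorem prime_cast_ne_zero : (p : ℂ) ≠ 0 := Nat.cast_ne_zero.mpr (NeZero.ne p)

theorem sum_P_succ (F : P p (k + 1) → ℂ) : ∑ x, F x = ∑ f, ∑ s, F (mkW f s) := by
  rw [← Equiv.sum_comp (wreathEquiv p k), Fintype.sum_prod_type]
  rfl

theorem induction_mkW {C : P p (k + 1) → Prop} (h : ∀ f s, C (mkW f s)) (x : P p (k + 1)) :
    C x := by
  rw [← mkW_base_top x]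
  exact h _ _

/-- For a function vanishing outside the base group, the bilinear form is computed there. -/
theorem cip_of_vanishing (χ ψ : P p (k + 1) → ℂ) (h : ∀ f s, s ≠ 1 → ψ (mkW f s) = 0) :
    cip χ ψ = (p : ℂ)⁻¹ * cip (χ ∘ mkB p k) (ψ ∘ mkB p k) := by
  unfold cip
  rw [nat_card_P_succ, sum_P_succ, Nat.cast_mul, mul_inv, mul_comm (_⁻¹) (_⁻¹), mul_assoc]
  congr 2
  refine Finset.sum_congr rfl fun f _ => ?_
  rw [Finset.sum_eq_single 1]
  · rw [Function.comp_apply, Function.comp_apply, map_inv]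
    rfl
  · intro s _ hs
    rw [mkW_inv, h _ _ (inv_ne_one.mpr hs), mul_zero]
  · simp

/-! #### The characters `𝒳(φ; ε)` -/

/-- The representation of `P_{p^k} ≀ P_p` on the tensor power, multiplied by `φ_ε`. -/
noncomputable def wreathRep {V : Type*} [AddCommGroup V] [Module ℂ V]
    (ρ : Representation ℂ (P p k) V) (ε : Fin p) :
    Representation ℂ (P p (k + 1)) (PiTensorProduct ℂ fun _ : Fin p => V) where
  toFun x := phi ε (top x) • wreathTensor ρ (base x) (top x)
  map_one' := by
    rw [← mkW_one, base_mkW, top_mkW, phi_one, one_smul]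
    exact wreathTensor_one ρ
  map_mul' x y := by
    induction x using induction_mkW with | _ f s
    induction y using induction_mkW with | _ g t
    rw [mkW_mul]
    simp only [base_mkW, top_mkW, phi_mul, Subgroup.coe_mul]
    rw [smul_mul_smul_comm, wreathTensor_mul]

theorem isChar_calX (φ : Irr (P p k)) (ε : Fin p) : IsChar (calX φ ε) := by
  have : calX φ ε = (wreathRep φ.2.choose_spec.choose ε).character := by
    funext x
    simp [calX, Representation.character, wreathRep, mul_comm]
  rw [this]
  exact isChar_character _

theorem calX_mkW (φ : Irr (P p k)) (ε : Fin p) (f : Fin p → P p k) (s : cyc p) :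
    calX φ ε (mkW f s) =
      LinearMap.trace ℂ _ (wreathTensor φ.2.choose_spec.choose f s) * phi ε s := by
  rw [calX, base_mkW, top_mkW]

/-- On the base group the rotation and `φ_ε` are trivial. The restriction is thus an irreducible
product, which gives irreducibility of `𝒳(φ; ε)` and recovers `φ`. -/
theorem calX_comp_mkB (φ : Irr (P p k)) (ε : Fin p) :
    calX φ ε ∘ mkB p k = piProd fun _ : Fin p => φ.1 := by
  funext f
  change calX φ ε (mkW f 1) = _
  rw [calX_mkW, phi_one, mul_one]
  conv_rhs => rw [φ.2.choose_spec.choose_spec.2]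
  exact trace_wreathTensor_base _ _

theorem isIrrChar_calX (φ : Irr (P p k)) (ε : Fin p) : IsIrrChar (calX φ ε) := by
  refine (isChar_calX φ ε).isIrrChar_of_cip_comp (mkB p k) ?_
  rw [calX_comp_mkB]
  exact (isIrrChar_piProd fun _ : Fin p => φ.2).cip_self

/-- The characters `𝒳(φ; ε)` do not vanish outside the base group. -/
theorem calX_not_vanishing (φ : Irr (P p k)) (ε : Fin p) :
    ¬ ∀ f s, s ≠ 1 → calX φ ε (mkW f s) = 0 := by
  intro h
  -- Vanishing outside the base group would make the norm `1/p` instead of `1`.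
  have h1 := cip_of_vanishing (calX φ ε) (calX φ ε) h
  rw [(isIrrChar_calX φ ε).cip_self, calX_comp_mkB,
    (isIrrChar_piProd fun _ : Fin p => φ.2).cip_self, mul_one] at h1
  have h2 : (p : ℂ) = 1 := by rw [← inv_inv (p : ℂ), ← h1, inv_one]
  exact (Fact.out : p.Prime).one_lt.ne' (by exact_mod_cast h2)

/-- The restriction to the base group gives `φ`. At some element outside it the trace is nonzero and
can be cancelled, leaving the value of `φ_ε` at a nontrivial rotation, which determines `ε`. -/
theorem calX_injective {φ φ' : Irr (P p k)} {ε ε' : Fin p} (h : calX φ ε = calX φ' ε') :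
    φ = φ' ∧ ε = ε' := by
  have hφ : φ = φ' := by
    have h1 := calX_comp_mkB φ ε
    rw [h, calX_comp_mkB] at h1
    exact congrFun (piProd_injective (χ := fun _ : Fin p => φ) (ψ := fun _ => φ') h1.symm) 0
  subst hφ
  refine ⟨rfl, ?_⟩
  by_contra hne
  refine calX_not_vanishing φ ε fun f s hs => ?_
  have h1 := congrFun h (mkW f s)
  rw [calX_mkW, calX_mkW] at h1
  rw [calX_mkW]
  by_contra h0
  exact hne (phi_injective hs (mul_left_cancel₀ (left_ne_zero_of_mul h0) h1))

theorem conjEquiv_one_iff {G : Type*} [Group G] {H : Subgroup G} {h : G}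
    (hh : h ∈ Subgroup.normalizer (H : Set G)) {x : H} : conjEquiv hh x = 1 ↔ x = 1 :=
  map_eq_one_iff (conjEquiv hh) (conjEquiv hh).injective

/-- The conjugate of `𝒳(φ; ε)` by an element `(h, …, h; m)`. -/
theorem calX_conj {h : Perm (Fin (p ^ k))} {m : Perm (Fin p)}
    (hh : h ∈ Subgroup.normalizer (P p k : Set (Perm (Fin (p ^ k)))))
    (hm : m ∈ Subgroup.normalizer (cyc p : Set (Perm (Fin p))))
    (hw : wr (fun _ => h) m ∈ Subgroup.normalizer (P p (k + 1) : Set (Perm (Fin (p ^ (k + 1))))))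
    (φ : Irr (P p k)) {ε ε' : Fin p} (hε : ∀ s, phi ε (conjEquiv hm s) = phi ε' s)
    (x : P p (k + 1)) : calX φ ε (conjEquiv hw x) = calX (φ.conj hh) ε' x := by
  induction x using induction_mkW with | _ f s
  rw [conjEquiv_mkW hh hm hw, calX_mkW, calX_mkW, hε]
  congr 1
  obtain ⟨hirr, hchar⟩ := φ.2.choose_spec.choose_spec
  obtain ⟨hirr', hchar'⟩ := (φ.conj hh).2.choose_spec.choose_spec
  set ρ := φ.2.choose_spec.choose
  set σ := (φ.conj hh).2.choose_spec.choose
  have hc := isIrreducible_comp_mulEquiv hirr (conjEquiv hh)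
  -- The representation chosen for `φ^h` need not be the conjugate of the one chosen for `φ`, but
  -- both are irreducible with the same character.
  obtain ⟨e⟩ : Nonempty (Representation.Equiv (ρ.comp (conjEquiv hh).toMonoidHom) σ) := by
    refine nonempty_equiv_of_character_eq _ _ ?_
    rw [← hchar']
    funext x
    exact (congrFun hchar (conjEquiv hh x)).symm
  rw [trace_wreathTensor_equiv e]
  exact trace_wreathTensor_conj ρ (fun i => conjEquiv hh (f i)) s m

/-! #### The induced characters -/

/-- `P_p` is abelian, so conjugation preserves the top component and no conjugate lies in the base
group. -/
theorem indProd_mkW_of_ne (θs : Fin p → Irr (P p k)) (f : Fin p → P p k) {s : cyc p}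
    (hs : s ≠ 1) : indProd θs (mkW f s) = 0 := by
  unfold indProd induced
  rw [finsum_eq_zero_of_forall_eq_zero, mul_zero]
  intro x
  induction x using induction_mkW with | _ g t
  rw [dif_neg]
  rw [mkW_inv, mkW_mul, mkW_mul, mkW_mem_baseGroup, cyc_mul_comm t⁻¹ s, inv_mul_cancel_right]
  exact hs

/-- Conjugation by `(g; t)` permutes the components by `t` and conjugates them inside `P_{p^k}`,
which the `θ_i` do not see; the sum over `g` cancels the order of the base group. -/
theorem indProd_mkW_one (θs : Fin p → Irr (P p k)) (f : Fin p → P p k) :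
    indProd θs (mkW f 1) = ∑ t : cyc p, ∏ i, (θs i).1 (f ((t : Perm (Fin p)) i)) := by
  unfold indProd induced
  rw [finsum_eq_sum_of_fintype, sum_P_succ, nat_card_baseGroup]
  have : ∀ (g : Fin p → P p k) (t : cyc p),
      (mkW g t)⁻¹ * mkW f 1 * mkW g t = mkW (fun i => (g ((t : Perm (Fin p)) i))⁻¹ *
        f ((t : Perm (Fin p)) i) * g ((t : Perm (Fin p)) i)) 1 := fun g t => by
    rw [mkW_inv, mkW_mul, mkW_mul]
    simp
  simp only [this, mkW_mem_baseGroup, dite_true, base_mkW, (θs _).2.isChar.conj_invariant]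
  rw [Finset.sum_const, Finset.card_univ, Fintype.card_eq_nat_card, nsmul_eq_mul, ← mul_assoc,
    inv_mul_cancel₀ card_ne_zero_complex, one_mul]

theorem indProd_comp_mkB (θs : Fin p → Irr (P p k)) :
    indProd θs ∘ mkB p k =
      fun f => ∑ t : cyc p, piProd (fun i => (θs ((t : Perm (Fin p)) i)).1) f := by
  funext f
  refine (indProd_mkW_one θs f).trans ?_
  rw [← Equiv.sum_comp (Equiv.inv (cyc p))]
  refine Finset.sum_congr rfl fun t _ => ?_
  rw [piProd, ← Equiv.prod_comp (t : Perm (Fin p))]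
  simp

/-- Supplies the symmetry required by `IsIrrChar.eq_of_cip_eq_natCast` without proving that the
induced function is a character. -/
theorem indProd_inv (θs : Fin p → Irr (P p k)) (x : P p (k + 1)) :
    indProd θs x⁻¹ = star (indProd θs x) := by
  induction x using induction_mkW with | _ f s
  rw [mkW_inv]
  by_cases hs : s = 1
  · subst hs
    simp only [inv_one, indProd_mkW_one, star_sum, star_prod, (θs _).2.isChar.apply_inv]
    rfl
  · rw [indProd_mkW_of_ne _ _ hs, indProd_mkW_of_ne _ _ (inv_ne_one.mpr hs), star_zero]

/-- Frobenius reciprocity for induction from the base group. -/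
theorem cip_indProd {χ : P p (k + 1) → ℂ} (hχ : IsChar χ) (θs : Fin p → Irr (P p k)) :
    cip χ (indProd θs) = cip (χ ∘ mkB p k) (piProd fun i => (θs i).1) := by
  rw [cip_of_vanishing _ _ fun f s hs => indProd_mkW_of_ne θs f hs, indProd_comp_mkB,
    cip_sum_right]
  -- Conjugation by `(1; t)` rotates the tuple and fixes the class function `χ`, so all `p` summands
  -- agree and cancel the factor `1/p`.
  have : ∀ t : cyc p, cip (χ ∘ mkB p k) (piProd fun i => (θs ((t : Perm (Fin p)) i)).1) =
      cip (χ ∘ mkB p k) (piProd fun i => (θs i).1) := fun t => by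
    unfold cip
    congr 1
    rw [← Equiv.sum_comp (Equiv.arrowCongr (t : Perm (Fin p)).symm (Equiv.refl (P p k)))]
    refine Finset.sum_congr rfl fun f _ => ?_
    have h1 : mkB p k (Equiv.arrowCongr (t : Perm (Fin p)).symm (Equiv.refl (P p k)) f) =
        (mkW 1 t)⁻¹ * mkB p k f * mkW 1 t := by
      change mkW _ 1 = _ * mkW f 1 * _
      rw [mkW_inv, mkW_mul, mkW_mul]
      simp [Equiv.arrowCongr, Function.comp_def]
    rw [Function.comp_apply, h1, hχ.conj_invariant, Function.comp_apply, piProd, piProd,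
      ← Equiv.prod_comp (t : Perm (Fin p)) fun i => (θs i).1 (f⁻¹ i)]
    rfl
  simp only [this, Finset.sum_const, Finset.card_univ, nsmul_eq_mul, card_cyc_complex]
  rw [← mul_assoc, inv_mul_cancel₀ prime_cast_ne_zero, one_mul]

/-- Two coinciding rotations of the tuple would make it invariant under a nontrivial rotation, hence
constant. So the restriction is a sum of `p` distinct irreducible characters, of norm `p`, and the
factor `1/p` leaves `1`. -/
theorem cip_indProd_self (θs : Fin p → Irr (P p k)) (h : ¬ ∀ i j, θs i = θs j) :
    cip (indProd θs) (indProd θs) = 1 := by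
  classical
  rw [cip_of_vanishing _ _ fun f s hs => indProd_mkW_of_ne θs f hs, indProd_comp_mkB,
    cip_sum_right]
  simp only [cip_sum_left]
  have : ∀ s t : cyc p, cip (piProd fun i => (θs ((t : Perm (Fin p)) i)).1)
      (piProd fun i => (θs ((s : Perm (Fin p)) i)).1) = if t = s then 1 else 0 := by
    intro s t
    split_ifs with hst
    · subst hst
      exact (isIrrChar_piProd fun i => (θs ((t : Perm (Fin p)) i)).2).cip_self
    · by_contra h0
      have h1 := piProd_injective (χ := fun i => θs ((t : Perm (Fin p)) i))
        (ψ := fun i => θs ((s : Perm (Fin p)) i))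
        ((isIrrChar_piProd fun i => (θs ((t : Perm (Fin p)) i)).2).eq_of_cip_ne_zero
          (isIrrChar_piProd fun i => (θs ((s : Perm (Fin p)) i)).2) h0)
      refine h (eq_of_comp_cyc_eq (s := t * s⁻¹) (fun hc => hst (mul_inv_eq_one.mp hc)) fun i => ?_)
      simpa using congrFun h1 ((s : Perm (Fin p))⁻¹ i)
  simp only [this, Finset.sum_ite_eq', Finset.mem_univ, if_true, Finset.sum_const,
    Finset.card_univ, nsmul_eq_mul, card_cyc_complex, mul_one]
  exact inv_mul_cancel₀ prime_cast_ne_zero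

/-- The `φ_ε` sum to zero at a nontrivial rotation; on the base group each `𝒳(φ; ε)` restricts to
the same product. -/
theorem indProd_const (φ : Irr (P p k)) :
    indProd (fun _ : Fin p => φ) = fun x => ∑ ε : Fin p, calX φ ε x := by
  funext x
  induction x using induction_mkW with | _ f s
  by_cases hs : s = 1
  · subst hs
    have h1 : ∀ ε, calX φ ε (mkW f 1) = piProd (fun _ : Fin p => φ.1) f :=
      fun ε => congrFun (calX_comp_mkB φ ε) f
    have h2 := congrFun (indProd_comp_mkB fun _ : Fin p => φ) f
    refine h2.trans ?_
    simp only [h1, Finset.sum_const, Finset.card_univ, nsmul_eq_mul, card_cyc_complex,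
      Fintype.card_fin]
  · simp only [indProd_mkW_of_ne _ _ hs, calX_mkW, ← Finset.mul_sum, sum_phi hs, mul_zero]

/-- Every irreducible character of `P_{p^k} ≀ P_p` is some `𝒳(φ; ε)` or induced from a product of
characters which are not all equal. -/
theorem irr_succ_cases (θ : Irr (P p (k + 1))) :
    (∃ (φ : Irr (P p k)) (ε : Fin p), θ.1 = calX φ ε) ∨
      ∃ θs : Fin p → Irr (P p k), (¬ ∀ i j, θs i = θs j) ∧ θ.1 = indProd θs := by
  have hc := θ.2.isChar.comp_hom (mkB p k)
  obtain ⟨ψ, hψ⟩ := hc.exists_constituent fun h0 =>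
    θ.2.apply_one_ne_zero (by simpa using congrFun h0 1)
  obtain ⟨θs, hθs⟩ := ψ.2.exists_eq_piProd
  obtain ⟨n, hn⟩ := hc.exists_cip_eq_natCast ψ.2.isChar
  rw [hn] at hψ
  rw [hθs, ← cip_indProd θ.2.isChar] at hn
  by_cases hall : ∀ i j, θs i = θs j
  · left
    have hconst : θs = fun _ => θs 0 := funext fun i => hall i 0
    rw [hconst, indProd_const, cip_sum_right] at hn
    -- The multiplicity `n` is the sum of the multiplicities of the `𝒳(θs 0; ε)` in `θ`, so one of
    -- them is nonzero.
    obtain ⟨ε, -, hε⟩ := Finset.exists_ne_zero_of_sum_ne_zero (hn.trans_ne hψ)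
    exact ⟨θs 0, ε, θ.2.eq_of_cip_ne_zero (isIrrChar_calX _ _) hε⟩
  · right
    exact ⟨θs, hall, θ.2.eq_of_cip_eq_natCast (indProd_inv θs) (cip_indProd_self θs hall)
      (Nat.cast_ne_zero.mp hψ) hn⟩

theorem calX_ne_indProd (φ : Irr (P p k)) (ε : Fin p) (θs : Fin p → Irr (P p k)) :
    calX φ ε ≠ indProd θs := fun h =>
  calX_not_vanishing φ ε fun f s hs => by rw [h, indProd_mkW_of_ne _ _ hs]

/-- The common restriction to the base group contains the product of the `θs`, and all its
constituents are products of rotations of `θs'`. -/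
theorem exists_cyc_of_indProd_eq {θs θs' : Fin p → Irr (P p k)} (h : indProd θs = indProd θs') :
    ∃ t : cyc p, ∀ i, θs i = θs' ((t : Perm (Fin p)) i) := by
  classical
  have hirr : ∀ (η : Fin p → Irr (P p k)) (t : cyc p),
      IsIrrChar (piProd fun i => (η ((t : Perm (Fin p)) i)).1) :=
    fun η t => isIrrChar_piProd fun i => (η _).2
  have h1 := indProd_comp_mkB θs
  rw [h, indProd_comp_mkB] at h1
  have h2 := congrArg (fun F => cip F (piProd fun i => (θs i).1)) h1
  simp only [cip_sum_left] at h2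
  have hne : ∑ t : cyc p, cip (piProd fun i => (θs ((t : Perm (Fin p)) i)).1)
      (piProd fun i => (θs i).1) ≠ 0 := by
    rw [Finset.sum_congr rfl fun t _ =>
      (hirr θs t).cip_eq (isIrrChar_piProd fun i => (θs i).2), Finset.sum_boole,
      Nat.cast_ne_zero, Finset.card_ne_zero]
    exact ⟨1, Finset.mem_filter.mpr ⟨Finset.mem_univ _, rfl⟩⟩
  obtain ⟨t, -, ht⟩ := Finset.exists_ne_zero_of_sum_ne_zero (h2.trans_ne hne)
  refine ⟨t, fun i => ?_⟩
  exact (congrFun (piProd_injective (χ := fun i => θs' ((t : Perm (Fin p)) i)) (ψ := θs)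
    ((hirr θs' t).eq_of_cip_ne_zero (hirr θs 1) ht)) i).symm

theorem indProd_comp_cyc (θs : Fin p → Irr (P p k)) (t : cyc p) :
    indProd (fun i => θs ((t : Perm (Fin p)) i)) = indProd θs := by
  funext x
  induction x using induction_mkW with | _ f s
  by_cases hs : s = 1
  · subst hs
    have h1 := congrFun (indProd_comp_mkB θs) f
    have h2 := congrFun (indProd_comp_mkB fun i => θs ((t : Perm (Fin p)) i)) f
    refine h2.trans (Eq.trans ?_ h1.symm)
    rw [← Equiv.sum_comp (Equiv.mulLeft t)
      fun s : cyc p => piProd (fun i => (θs ((s : Perm (Fin p)) i)).1) f]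
    rfl
  · rw [indProd_mkW_of_ne _ _ hs, indProd_mkW_of_ne _ _ hs]

/-- The conjugate of an induced character by an element `(h, …, h; m)`. -/
theorem indProd_conj {h : Perm (Fin (p ^ k))} {m : Perm (Fin p)}
    (hh : h ∈ Subgroup.normalizer (P p k : Set (Perm (Fin (p ^ k)))))
    (hm : m ∈ Subgroup.normalizer (cyc p : Set (Perm (Fin p))))
    (hw : wr (fun _ => h) m ∈ Subgroup.normalizer (P p (k + 1) : Set (Perm (Fin (p ^ (k + 1))))))
    (θs : Fin p → Irr (P p k)) (x : P p (k + 1)) :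
    indProd θs (conjEquiv hw x) = indProd (fun i => (θs (m⁻¹ i)).conj hh) x := by
  induction x using induction_mkW with | _ f s
  rw [conjEquiv_mkW hh hm hw]
  by_cases hs : s = 1
  · subst hs
    rw [map_one, indProd_mkW_one, indProd_mkW_one]
    -- Replacing `t` by `m⁻¹ t m` changes `m (t i)` into `t (m i)`; reindexing the product by `m`
    -- then puts `m⁻¹` on the indices of `θs`.
    rw [← Equiv.sum_comp (conjEquiv hm).toEquiv]
    refine Finset.sum_congr rfl fun t _ => ?_
    conv_rhs => rw [← Equiv.prod_comp m]
    simp [Irr.conj, conjEquiv]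
  · rw [indProd_mkW_of_ne _ _ hs, indProd_mkW_of_ne _ _ ((conjEquiv_one_iff hm).not.mpr hs)]

end WreathCharacters

/-! ### Tree functions of irreducible characters -/

section TreeFunctions

variable {p : ℕ}

theorem Labeling.root_node {k : ℕ} (f : Fin p → Labeling p k) (ε : Fin (p + 1)) :
    (Labeling.node f ε).root = ε := rfl

theorem Labeling.sub_node {k : ℕ} (f : Fin p → Labeling p k) (ε : Fin (p + 1)) :
    (Labeling.node f ε).sub = f := rfl

/-- A family `γ` is a rotation `γ_∅` together with an independent family on each subtree, so
equivalence can be tested recursively. -/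
theorem Labeling.toTree_succ_eq_iff {k : ℕ} {t₁ t₂ : Labeling p (k + 1)} :
    t₁.toTree = t₂.toTree ↔ t₁.root = t₂.root ∧
      ∃ s : cyc p, ∀ i, (t₁.sub i).toTree = (t₂.sub ((s : Perm (Fin p)) i)).toTree := by
  refine Quotient.eq.trans ⟨?_, ?_⟩
  · rintro ⟨γ, hγ, h⟩
    refine ⟨h ⟨[], Nat.succ_pos k⟩, ⟨γ [], hγ []⟩, fun i => Quotient.eq.mpr
      ⟨fun q => γ (i :: q), fun q => hγ _, fun q => h ⟨i :: q.1, Nat.succ_lt_succ q.2⟩⟩⟩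
  · rintro ⟨hroot, s, h⟩
    choose δ hδ h using fun i => Quotient.eq.mp (h i)
    refine ⟨fun q => q.casesOn s δ, fun q => ?_, ?_⟩
    · cases q with
      | nil => exact s.2
      | cons i q => exact hδ i q
    · rintro ⟨_ | ⟨i, q⟩, hq⟩
      · exact hroot
      · exact h i ⟨q, Nat.lt_of_succ_lt_succ hq⟩

theorem Labeling.toTree_eq_node_iff {k : ℕ} {t : Labeling p (k + 1)} {F : Fin p → TreeFun p k}
    {ε : Fin (p + 1)} : t.toTree = TreeFun.node F ε ↔ t.root = ε ∧
      ∃ s : cyc p, ∀ i, (t.sub i).toTree = F ((s : Perm (Fin p)) i) := by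
  have : ∀ i, (Quotient.out (F i)).toTree = F i := fun i => Quotient.out_eq (F i)
  rw [TreeFun.node, toTree_succ_eq_iff, root_node, sub_node]
  simp only [this]

theorem TreeFun.node_eq_node_iff {k : ℕ} {F F' : Fin p → TreeFun p k} {ε ε' : Fin (p + 1)} :
    TreeFun.node F ε = TreeFun.node F' ε' ↔ ε = ε' ∧
      ∃ s : cyc p, ∀ i, F i = F' ((s : Perm (Fin p)) i) := by
  have : ∀ i, (Quotient.out (F i)).toTree = F i := fun i => Quotient.out_eq (F i)
  rw [TreeFun.node, Labeling.toTree_eq_node_iff, Labeling.root_node, Labeling.sub_node]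
  simp only [this]

variable [Fact p.Prime]

instance subsingleton_treeFun_zero : Subsingleton (TreeFun p 0) :=
  ⟨fun S T => Quotient.inductionOn₂ S T fun _ _ =>
    congrArg _ (funext fun s => absurd s.2 (Nat.not_lt_zero _))⟩

/-- The pair chosen in the definition of `tree` is the only one available. -/
theorem tree_of_eq_calX {k : ℕ} {θ : Irr (P p (k + 1))} {φ : Irr (P p k)} {ε : Fin p}
    (h : θ.1 = calX φ ε) : tree θ = TreeFun.node (fun _ => tree φ) ε.castSucc := by
  have hex : ∃ (φ : Irr (P p k)) (ε : Fin p), θ.1 = calX φ ε := ⟨φ, ε, h⟩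
  rw [tree, dif_pos hex]
  obtain ⟨h1, h2⟩ := calX_injective (hex.choose_spec.choose_spec.symm.trans h)
  rw [h2, h1]

/-- The tuple chosen in the definition of `tree` may differ from `θs` by a rotation, which
equivalence at the root absorbs. -/
theorem tree_of_eq_indProd {k : ℕ} {θ : Irr (P p (k + 1))} {θs : Fin p → Irr (P p k)}
    (hne : ¬ ∀ i j, θs i = θs j) (h : θ.1 = indProd θs) :
    tree θ = TreeFun.node (fun i => tree (θs i)) (Fin.last p) := by
  have hnot : ¬ ∃ (φ : Irr (P p k)) (ε : Fin p), θ.1 = calX φ ε := by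
    rintro ⟨φ, ε, h'⟩
    exact calX_ne_indProd φ ε θs (h'.symm.trans h)
  have hex : ∃ θs : Fin p → Irr (P p k), (¬ ∀ i j, θs i = θs j) ∧ θ.1 = indProd θs :=
    ⟨θs, hne, h⟩
  rw [tree, dif_neg hnot, dif_pos hex, TreeFun.node_eq_node_iff]
  obtain ⟨t, ht⟩ := exists_cyc_of_indProd_eq (hex.choose_spec.2.symm.trans h)
  exact ⟨rfl, t, fun i => by rw [ht]⟩

theorem subsingleton_P_zero : Subsingleton (P p 0) := by
  have : Subsingleton (Fin (p ^ 0)) := by rw [pow_zero]; infer_instance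
  infer_instance

instance subsingleton_irr_P_zero : Subsingleton (Irr (P p 0)) := by
  have := subsingleton_P_zero (p := p)
  refine ⟨fun χ ψ => Subtype.ext (χ.2.eq_of_cip_ne_zero ψ.2 ?_)⟩
  have h : ∀ g : P p 0, χ.1 g * ψ.1 g⁻¹ = χ.1 1 * ψ.1 1 := fun g => by
    rw [Subsingleton.elim g 1, inv_one]
  simp only [cip, h, Finset.sum_const, Finset.card_univ, nsmul_eq_mul, Fintype.card_eq_nat_card]
  rw [← mul_assoc, inv_mul_cancel₀ card_ne_zero_complex, one_mul]
  exact mul_ne_zero χ.2.apply_one_ne_zero ψ.2.apply_one_ne_zero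

/-- An irreducible character of `P_{p^k}` is determined by its tree function. -/
theorem tree_injective (k : ℕ) : Function.Injective (tree : Irr (P p k) → TreeFun p k) := by
  induction k with
  | zero => exact fun χ ψ _ => Subsingleton.elim χ ψ
  | succ k ih =>
    intro χ ψ h
    rcases irr_succ_cases χ with ⟨φ, ε, hχ⟩ | ⟨θs, hθs, hχ⟩ <;>
      rcases irr_succ_cases ψ with ⟨φ', ε', hψ⟩ | ⟨θs', hθs', hψ⟩
    · rw [tree_of_eq_calX hχ, tree_of_eq_calX hψ, TreeFun.node_eq_node_iff] at h
      obtain ⟨h1, s, h2⟩ := h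
      apply Subtype.ext
      rw [hχ, hψ, ih (h2 0), Fin.castSucc_injective p h1]
    · rw [tree_of_eq_calX hχ, tree_of_eq_indProd hθs' hψ, TreeFun.node_eq_node_iff] at h
      exact absurd h.1 (Fin.castSucc_lt_last ε).ne
    · rw [tree_of_eq_indProd hθs hχ, tree_of_eq_calX hψ, TreeFun.node_eq_node_iff] at h
      exact absurd h.1.symm (Fin.castSucc_lt_last ε').ne
    · rw [tree_of_eq_indProd hθs hχ, tree_of_eq_indProd hθs' hψ, TreeFun.node_eq_node_iff] at h
      obtain ⟨-, s, h2⟩ := h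
      apply Subtype.ext
      have : θs = fun i => θs' ((s : Perm (Fin p)) i) := funext fun i => ih (h2 i)
      rw [hχ, hψ, this, indProd_comp_cyc]

/-- For label `p` the subtrees must differ whenever the characters do; this is where
`tree_injective` enters. -/
theorem tree_mem_admissibleTrees {k : ℕ} (θ : Irr (P p k)) : tree θ ∈ admissibleTrees p k := by
  induction k with
  | zero => exact fun t _ => trivial
  | succ k ih =>
    intro t ht
    rcases irr_succ_cases θ with ⟨φ, ε, h⟩ | ⟨θs, hθs, h⟩
    · rw [tree_of_eq_calX h, Labeling.toTree_eq_node_iff] at ht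
      obtain ⟨hr, s, hs⟩ := ht
      refine ⟨fun i => ih φ _ (hs i), fun _ i j => (hs i).trans (hs j).symm, fun hl => ?_⟩
      exact absurd (hr.symm.trans hl) (Fin.castSucc_lt_last ε).ne
    · rw [tree_of_eq_indProd hθs h, Labeling.toTree_eq_node_iff] at ht
      obtain ⟨hr, s, hs⟩ := ht
      refine ⟨fun i => ih _ _ (hs i), fun hl => absurd hr hl, fun _ hall => hθs fun i j => ?_⟩
      have := hall ((s : Perm (Fin p))⁻¹ i) ((s : Perm (Fin p))⁻¹ j)
      rw [hs, hs] at this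
      simpa using tree_injective k this

theorem Irr.conj_one {G : Type*} [Group G] {H : Subgroup G} (χ : Irr H)
    (h : (1 : G) ∈ Subgroup.normalizer (H : Set G)) : χ.conj h = χ :=
  Subtype.ext (funext fun x => congrArg χ.1 (Subtype.ext (by simp [conjEquiv])))

theorem Irr.conj_injective {G : Type*} [Group G] {H : Subgroup G} {h : G}
    (hh : h ∈ Subgroup.normalizer (H : Set G)) :
    Function.Injective fun χ : Irr H => χ.conj hh := by
  intro χ ψ hχψ
  refine Subtype.ext (funext fun x => ?_)
  have := congrFun (congrArg Subtype.val hχψ) ((conjEquiv hh).symm x)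
  simpa [Irr.conj] using this

theorem tree_conj_of_eq_indProd {k : ℕ} {h : Perm (Fin (p ^ k))} {m : Perm (Fin p)}
    (hh : h ∈ Subgroup.normalizer (P p k : Set (Perm (Fin (p ^ k)))))
    (hm : m ∈ Subgroup.normalizer (cyc p : Set (Perm (Fin p))))
    (hw : wr (fun _ => h) m ∈ Subgroup.normalizer (P p (k + 1) : Set (Perm (Fin (p ^ (k + 1))))))
    {θ : Irr (P p (k + 1))} {θs : Fin p → Irr (P p k)} (hne : ¬ ∀ i j, θs i = θs j)
    (hθ : θ.1 = indProd θs) :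
    tree (θ.conj hw) = TreeFun.node (fun i => tree ((θs (m⁻¹ i)).conj hh)) (Fin.last p) := by
  refine tree_of_eq_indProd (fun hall => hne fun i j => ?_) (funext fun x => ?_)
  · simpa using Irr.conj_injective hh (hall (m i) (m j))
  · rw [← indProd_conj hh hm hw, ← hθ]
    rfl

theorem tree_conj_of_eq_calX {k : ℕ} {h : Perm (Fin (p ^ k))} {m : Perm (Fin p)}
    (hh : h ∈ Subgroup.normalizer (P p k : Set (Perm (Fin (p ^ k)))))
    (hm : m ∈ Subgroup.normalizer (cyc p : Set (Perm (Fin p))))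
    (hw : wr (fun _ => h) m ∈ Subgroup.normalizer (P p (k + 1) : Set (Perm (Fin (p ^ (k + 1))))))
    {θ : Irr (P p (k + 1))} {φ : Irr (P p k)} {ε ε' : Fin p}
    (hε : ∀ s, phi ε (conjEquiv hm s) = phi ε' s) (hθ : θ.1 = calX φ ε) :
    tree (θ.conj hw) = TreeFun.node (fun _ => tree (φ.conj hh)) ε'.castSucc := by
  refine tree_of_eq_calX (funext fun x => ?_)
  rw [← calX_conj hh hm hw φ hε, ← hθ]
  rfl

/-- The action of `σ_j^{(k)}` on tree functions of irreducible characters is the explicit one. -/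
theorem tree_conj_sigma (u : (ZMod p)ˣ) {k : ℕ} (j : ℕ) (θ : Irr (P p k))
    (h : sigma u k j ∈ Subgroup.normalizer (P p k : Set (Perm (Fin (p ^ k)))))
    (t : Labeling p k) (ht : t.toTree = tree θ) :
    tree (θ.conj h) = (t.sigmaAct u j).toTree := by
  induction k with
  | zero => exact Subsingleton.elim _ _
  | succ k ih =>
    by_cases hj : j = k + 1
    · have hm := mulPerm_mem_normalizer u
      have hact : t.sigmaAct u j =
          Labeling.node (fun i => t.sub ((mulPerm u)⁻¹ i)) (tauLabel u t.root) := by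
        rw [Labeling.sigmaAct, if_pos hj]
      have hσ : sigma u (k + 1) j = wr (fun _ => 1) (mulPerm u) := by
        rw [sigma, if_pos hj]; rfl
      generalize sigma u (k + 1) j = g at h hσ
      subst hσ
      rw [hact]
      symm
      rcases irr_succ_cases θ with ⟨φ, ε, hθ⟩ | ⟨θs, hθs, hθ⟩
      · rw [tree_of_eq_calX hθ, Labeling.toTree_eq_node_iff] at ht
        obtain ⟨hr, s, hs⟩ := ht
        rw [tree_conj_of_eq_calX (one_mem _) hm h (phi_conj_mulPerm u ε) hθ,
          Labeling.toTree_eq_node_iff, Labeling.root_node, Labeling.sub_node, hr]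
        -- All subtrees have the same class here, so permuting them has no effect and only the label
        -- moves.
        exact ⟨tauLabel_castSucc u ε, 1, fun i => by rw [hs, Irr.conj_one]⟩
      · rw [tree_of_eq_indProd hθs hθ, Labeling.toTree_eq_node_iff] at ht
        obtain ⟨hr, s, hs⟩ := ht
        rw [tree_conj_of_eq_indProd (one_mem _) hm h hθs hθ,
          Labeling.toTree_eq_node_iff, Labeling.root_node, Labeling.sub_node, hr]
        -- If `t` differs from the tuple of trees by the rotation `s`, then after permuting both by
        -- `m⁻¹` they differ by `m s m⁻¹`, again a rotation since `m` normalizes `P_p`.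
        refine ⟨if_pos rfl, conjEquiv (inv_mem hm) s, fun i => ?_⟩
        rw [hs, Irr.conj_one]
        simp [conjEquiv]
    · have hact : t.sigmaAct u j =
          Labeling.node (fun i => Labeling.sigmaAct u j (t.sub i)) t.root := by
        rw [Labeling.sigmaAct, if_neg hj]
      have hσ : sigma u (k + 1) j = wr (fun _ => sigma u k j) 1 := by
        rw [sigma, if_neg hj]
      have hσk := sigma_mem_normalizer u k j
      generalize sigma u (k + 1) j = g at h hσ
      subst hσ
      rw [hact]
      symm
      rcases irr_succ_cases θ with ⟨φ, ε, hθ⟩ | ⟨θs, hθs, hθ⟩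
      · rw [tree_of_eq_calX hθ, Labeling.toTree_eq_node_iff] at ht
        obtain ⟨hr, s, hs⟩ := ht
        rw [tree_conj_of_eq_calX hσk (one_mem _) h (ε' := ε)
            (fun s => congrArg _ (Subtype.ext (by simp [conjEquiv]))) hθ,
          Labeling.toTree_eq_node_iff, Labeling.root_node, Labeling.sub_node, hr]
        exact ⟨rfl, 1, fun i => (ih φ hσk _ (hs i)).symm⟩
      · rw [tree_of_eq_indProd hθs hθ, Labeling.toTree_eq_node_iff] at ht
        obtain ⟨hr, s, hs⟩ := ht
        rw [tree_conj_of_eq_indProd hσk (one_mem _) h hθs hθ,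
          Labeling.toTree_eq_node_iff, Labeling.root_node, Labeling.sub_node, hr]
        exact ⟨rfl, s, fun i => (ih _ hσk _ (hs i)).symm⟩

end TreeFunctions

theorem Irr.conj_of_eq_one {G : Type*} [Group G] {H : Subgroup G} (χ : Irr H) {g : G}
    (hg : g ∈ Subgroup.normalizer (H : Set G)) (h : g = 1) : χ.conj hg = χ := by
  subst h
  exact χ.conj_one hg

theorem Irr.conj_congr {G : Type*} [Group G] {H : Subgroup G} (χ : Irr H) {g g' : G}
    (hg : g ∈ Subgroup.normalizer (H : Set G)) (hg' : g' ∈ Subgroup.normalizer (H : Set G))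
    (h : g = g') : χ.conj hg = χ.conj hg' := by
  subst h
  rfl

theorem closure_swap_finRotate {a : ℕ} (h : 2 ≤ a) :
    Subgroup.closure {Equiv.swap (⟨0, Nat.lt_of_lt_of_le Nat.zero_lt_two h⟩ : Fin a) ⟨1, h⟩,
      finRotate a} = ⊤ := by
  obtain ⟨n, rfl⟩ : ∃ n, a = n + 2 := ⟨a - 2, by omega⟩
  rw [Set.pair_comm]
  have := Perm.closure_cycle_adjacent_swap (isCycle_finRotate (n := n)) support_finRotate 0
  rw [finRotate_apply, zero_add] at this
  exact this

/-! ### The direct product `P_n` and permutations of its blocks. -/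

namespace PadicExpansion

variable {p n : ℕ} (E : PadicExpansion p n)

theorem blockHom_apply (h : ∀ i, Fin (E.a i) → Perm (Fin (p ^ E.k i))) (i : Fin E.t)
    (j : Fin (E.a i)) (r : Fin (p ^ E.k i)) :
    E.blockHom h (E.point ⟨i, j, r⟩) = E.point ⟨i, j, h i j r⟩ := by
  simp [blockHom, Equiv.permCongr_apply, Equiv.prodShear]

theorem blockHom_injective : Function.Injective E.blockHom := by
  intro f g h
  funext i j
  refine Equiv.ext fun r => ?_
  have := congrArg (fun e : Perm (Fin n) => e (E.point ⟨i, j, r⟩)) h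
  simp only [blockHom_apply] at this
  simpa using E.point.injective this

theorem permBlocks_apply_self (i : Fin E.t) (π : Perm (Fin (E.a i))) (j : Fin (E.a i))
    (r : Fin (p ^ E.k i)) :
    E.permBlocks i π (E.point ⟨i, j, r⟩) = E.point ⟨i, π j, r⟩ := by
  simp [permBlocks, Equiv.permCongr_apply]

theorem permBlocks_apply_of_ne {i i' : Fin E.t} (h : i' ≠ i) (π : Perm (Fin (E.a i)))
    (j : Fin (E.a i')) (r : Fin (p ^ E.k i')) :
    E.permBlocks i π (E.point ⟨i', j, r⟩) = E.point ⟨i', j, r⟩ := by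
  simp [permBlocks, Equiv.permCongr_apply, Pi.mulSingle_eq_of_ne h]

/-- `permBlocks` as a homomorphism of groups. -/
def permBlocksHom (i : Fin E.t) : Perm (Fin (E.a i)) →* Perm (Fin n) :=
  MonoidHom.mk' (E.permBlocks i) fun π π' => by
    refine Equiv.ext fun x => ?_
    obtain ⟨⟨i', j, r⟩, rfl⟩ := E.point.surjective x
    by_cases h : i' = i
    · subst h
      simp only [Perm.mul_apply, permBlocks_apply_self]
    · simp only [Perm.mul_apply, E.permBlocks_apply_of_ne h]

theorem permBlocks_inv (i : Fin E.t) (π : Perm (Fin (E.a i))) :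
    (E.permBlocks i π)⁻¹ = E.permBlocks i π⁻¹ :=
  (map_inv (E.permBlocksHom i) π).symm

/-- Conjugation by a permutation of blocks permutes the components. -/
theorem blockHom_mul_permBlocks (h : ∀ i, Fin (E.a i) → Perm (Fin (p ^ E.k i))) (i : Fin E.t)
    (π : Perm (Fin (E.a i))) :
    E.blockHom h * E.permBlocks i π =
      E.permBlocks i π * E.blockHom (Function.update h i fun j => h i (π j)) := by
  refine Equiv.ext fun x => ?_
  obtain ⟨⟨i', j, r⟩, rfl⟩ := E.point.surjective x
  by_cases hi : i' = i
  · subst hi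
    simp only [Perm.mul_apply, permBlocks_apply_self, blockHom_apply, Function.update_self]
  · simp only [Perm.mul_apply, E.permBlocks_apply_of_ne hi, blockHom_apply,
      Function.update_of_ne hi]

/-- `ξ_i` and `ζ_i` are the images of an adjacent transposition and a full cycle, which generate the
symmetric group; for `a_i = 1` everything is trivial. -/
theorem rhoGroup_eq_range (i : Fin E.t) : E.rhoGroup i = (E.permBlocksHom i).range := by
  rw [MonoidHom.range_eq_map, rhoGroup]
  by_cases h : 2 ≤ E.a i
  · rw [← closure_swap_finRotate h, MonoidHom.map_closure, Set.image_pair, xi, dif_pos h]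
    rfl
  · have ha : E.a i = 1 := by have := E.a_pos i; omega
    have : Subsingleton (Fin (E.a i)) := by rw [ha]; infer_instance
    have hz : E.zeta i = 1 := by
      rw [zeta, Subsingleton.elim (finRotate (E.a i)) 1]
      exact map_one (E.permBlocksHom i)
    rw [xi, dif_neg h, hz, Set.pair_eq_singleton, Subgroup.closure_singleton_one,
      Subsingleton.elim (⊤ : Subgroup (Perm (Fin (E.a i)))) ⊥, Subgroup.map_bot]

variable [Fact p.Prime]

theorem permBlocksHom_injective (i : Fin E.t) : Function.Injective (E.permBlocksHom i) := by
  intro π π' h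
  have hp : 0 < p ^ E.k i := Nat.pow_pos (NeZero.pos p)
  refine Equiv.ext fun j => ?_
  have := congrArg (fun e : Perm (Fin n) => e (E.point ⟨i, j, ⟨0, hp⟩⟩)) h
  change E.permBlocks i π _ = E.permBlocks i π' _ at this
  rw [permBlocks_apply_self, permBlocks_apply_self] at this
  simpa using E.point.injective this

theorem nonempty_rhoGroup_mulEquiv (i : Fin E.t) :
    Nonempty (E.rhoGroup i ≃* Perm (Fin (E.a i))) := by
  rw [rhoGroup_eq_range]
  exact ⟨(MonoidHom.ofInjective (E.permBlocksHom_injective i)).symm⟩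

theorem prodHom_injective : Function.Injective E.prodHom := by
  intro x y h
  have := E.blockHom_injective h
  funext i j
  exact Subtype.ext (congrFun (congrFun this i) j)

/-- The group `P_n` is the direct product of the groups `P_{p^{k_i}}`. -/
noncomputable def prodEquiv : (∀ i, Fin (E.a i) → P p (E.k i)) ≃* E.sylow :=
  MonoidHom.ofInjective E.prodHom_injective

theorem isProd_iff {θ : Irr E.sylow} {θs : ∀ i, Fin (E.a i) → Irr (P p (E.k i))} :
    E.IsProd θ θs ↔ θ.1 ∘ E.prodEquiv = piProd fun i => piProd fun j => (θs i j).1 :=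
  ⟨fun h => funext h, fun h => congrFun h⟩

theorem IsProd.unique {θ : Irr E.sylow} {θs θs' : ∀ i, Fin (E.a i) → Irr (P p (E.k i))}
    (h : E.IsProd θ θs) (h' : E.IsProd θ θs') : θs = θs' := by
  have key := (E.isProd_iff.mp h).symm.trans (E.isProd_iff.mp h')
  have hirr : ∀ (η : ∀ i, Fin (E.a i) → Irr (P p (E.k i))) i,
      IsIrrChar (piProd fun j => (η i j).1) := fun η i => isIrrChar_piProd fun j => (η i j).2
  have h1 := piProd_injective (χ := fun i => ⟨_, hirr θs i⟩) (ψ := fun i => ⟨_, hirr θs' i⟩) key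
  exact funext fun i => piProd_injective (congrArg Subtype.val (congrFun h1 i))

theorem exists_isProd (θ : Irr E.sylow) : ∃ θs, E.IsProd θ θs := by
  obtain ⟨Ψ, hΨ⟩ := (θ.2.comp_equiv E.prodEquiv).exists_eq_piProd
  choose θs hθs using fun i => (Ψ i).2.exists_eq_piProd
  refine ⟨θs, E.isProd_iff.mpr (hΨ.trans ?_)⟩
  exact congrArg _ (funext hθs)

theorem IsProd.tree_eq {θ : Irr E.sylow} {θs : ∀ i, Fin (E.a i) → Irr (P p (E.k i))}
    (h : E.IsProd θ θs) (i : Fin E.t) (j : Fin (E.a i)) :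
    E.tree θ i j = SylowTree.tree (θs i j) := by
  have hex : ∃ θs, E.IsProd θ θs := ⟨θs, h⟩
  rw [tree, dif_pos hex, IsProd.unique E hex.choose_spec h]

/-- Common to both actions: `c` is conjugation by `g` in the coordinates of the direct product, and
only its effect on the product of values matters. -/
theorem IsProd.conj {θ : Irr E.sylow} {θs θs' : ∀ i, Fin (E.a i) → Irr (P p (E.k i))}
    (h : E.IsProd θ θs) {g : Perm (Fin n)} (hg : g ∈ E.N)
    (c : (∀ i, Fin (E.a i) → P p (E.k i)) → ∀ i, Fin (E.a i) → P p (E.k i))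
    (hc : ∀ x, g⁻¹ * E.prodHom x * g = E.prodHom (c x))
    (hprod : ∀ x, ∏ i, ∏ j, (θs i j).1 (c x i j) = ∏ i, ∏ j, (θs' i j).1 (x i j)) :
    E.IsProd (θ.conj hg) θs' := by
  intro x
  rw [← hprod, ← h]
  exact congrArg θ.1 (Subtype.ext (hc x))

/-! #### Conjugation by elements acting inside the blocks -/

theorem blockHom_conj (h : ∀ i, Fin (E.a i) → Perm (Fin (p ^ E.k i)))
    (hh : ∀ i j, h i j ∈ Subgroup.normalizer (P p (E.k i) : Set (Perm (Fin (p ^ E.k i)))))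
    (x : ∀ i, Fin (E.a i) → P p (E.k i)) :
    (E.blockHom h)⁻¹ * E.prodHom x * E.blockHom h =
      E.prodHom fun i j => conjEquiv (hh i j) (x i j) := by
  change _ * E.blockHom _ * _ = E.blockHom _
  rw [← map_inv, ← map_mul, ← map_mul]
  rfl

theorem blockHom_mem_N (h : ∀ i, Fin (E.a i) → Perm (Fin (p ^ E.k i)))
    (hh : ∀ i j, h i j ∈ Subgroup.normalizer (P p (E.k i) : Set (Perm (Fin (p ^ E.k i))))) :
    E.blockHom h ∈ E.N := by
  refine mem_normalizer_of_conj ?_ ?_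
  · rintro _ ⟨x, rfl⟩
    have := E.blockHom_conj h⁻¹ (fun i j => inv_mem (hh i j)) x
    rw [map_inv, inv_inv] at this
    exact ⟨_, this.symm⟩
  · rintro _ ⟨x, rfl⟩
    exact ⟨_, (E.blockHom_conj h hh x).symm⟩

theorem IsProd.conj_blockHom {θ : Irr E.sylow} {θs : ∀ i, Fin (E.a i) → Irr (P p (E.k i))}
    (hθ : E.IsProd θ θs) (h : ∀ i, Fin (E.a i) → Perm (Fin (p ^ E.k i)))
    (hh : ∀ i j, h i j ∈ Subgroup.normalizer (P p (E.k i) : Set (Perm (Fin (p ^ E.k i)))))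
    (hN : E.blockHom h ∈ E.N) :
    E.IsProd (θ.conj hN) fun i j => (θs i j).conj (hh i j) :=
  IsProd.conj E hθ hN _ (E.blockHom_conj h hh) fun _ => rfl

/-! #### Conjugation by permutations of the blocks -/

theorem permBlocks_conj (i : Fin E.t) (π : Perm (Fin (E.a i)))
    (x : ∀ i, Fin (E.a i) → P p (E.k i)) :
    (E.permBlocks i π)⁻¹ * E.prodHom x * E.permBlocks i π =
      E.prodHom (Function.update x i fun j => x i (π j)) := by
  change _ * E.blockHom _ * _ = E.blockHom _
  rw [mul_assoc, blockHom_mul_permBlocks, inv_mul_cancel_left]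
  congr 1
  funext i'
  by_cases h : i' = i
  · subst h
    simp only [Function.update_self]
  · simp only [Function.update_of_ne h]

theorem permBlocks_mem_N (i : Fin E.t) (π : Perm (Fin (E.a i))) : E.permBlocks i π ∈ E.N := by
  refine mem_normalizer_of_conj ?_ ?_
  · rintro _ ⟨x, rfl⟩
    have := E.permBlocks_conj i π⁻¹ x
    rw [← permBlocks_inv, inv_inv] at this
    exact ⟨_, this.symm⟩
  · rintro _ ⟨x, rfl⟩
    exact ⟨_, (E.permBlocks_conj i π x).symm⟩

theorem IsProd.conj_permBlocks {θ : Irr E.sylow} {θs : ∀ i, Fin (E.a i) → Irr (P p (E.k i))}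
    (hθ : E.IsProd θ θs) (i : Fin E.t) (π : Perm (Fin (E.a i))) (hN : E.permBlocks i π ∈ E.N) :
    E.IsProd (θ.conj hN) (Function.update θs i fun j => θs i (π⁻¹ j)) := by
  refine IsProd.conj E hθ hN _ (E.permBlocks_conj i π) fun x => ?_
  refine Finset.prod_congr rfl fun i' _ => ?_
  by_cases h : i' = i
  · subst h
    simp only [Function.update_self]
    rw [← Equiv.prod_comp π fun j => (θs i' (π⁻¹ j)).1 (x i' j)]
    simp
  · simp only [Function.update_of_ne h]

theorem permBlocks_induces (i : Fin E.t) (π : Perm (Fin (E.a i))) :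
    E.Induces i (E.permBlocks i π) π := by
  intro x
  have key : ∀ h, MulAut.conj (E.permBlocks i π) (E.shiftHom i x h) = E.shiftHom i (π x) h := by
    intro h
    rw [MulAut.conj_apply, mul_inv_eq_iff_eq_mul]
    change _ * E.blockHom _ = E.blockHom _ * _
    rw [blockHom_mul_permBlocks]
    congr 2
    funext i'
    by_cases hi : i' = i
    · subst hi
      funext j
      simp [Pi.mulSingle_apply]
    · simp [Function.update_of_ne hi, Pi.mulSingle_eq_of_ne hi]
  rw [factor, factor, Subgroup.map_map]
  exact congrArg (fun F => Subgroup.map F _) (MonoidHom.ext key)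

/-- For positive exponent each factor contains a nontrivial element, supported on its own block. For
`k_i = 0` all these factors are trivial and coincide. -/
theorem factor_injective {i : Fin E.t} (hk : E.k i ≠ 0) : Function.Injective (E.factor i) := by
  intro x y hxy
  obtain ⟨k, hk'⟩ := Nat.exists_eq_succ_of_ne_zero hk
  have hg : ∃ g ∈ P p (E.k i), g ≠ 1 := by
    rw [hk']
    refine ⟨_, wr_top_mem (k := k) (Subgroup.mem_zpowers (finRotate p)), fun h => ?_⟩
    rw [← wr_one] at h
    have h1 := congrArg (fun e : Perm (Fin p) => ((e 0 : Fin p) : ℕ)) (wr_injective h).2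
    have h2 := val_finRotate_pow 1 (0 : Fin p)
    have hp := (Fact.out : p.Prime).one_lt
    simp only [pow_one, Fin.val_zero, zero_add, Nat.mod_eq_of_lt hp] at h2
    simp only [h2, Perm.one_apply, Fin.val_zero] at h1
    exact one_ne_zero h1
  obtain ⟨g, hg, hg1⟩ := hg
  by_contra hne
  have hmem : E.shiftHom i x g ∈ E.factor i y := hxy ▸ ⟨g, hg, rfl⟩
  obtain ⟨g', -, h⟩ := hmem
  have h1 := congrFun (congrFun (E.blockHom_injective h) i) x
  simp [Pi.mulSingle_eq_of_ne hne] at h1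
  exact hg1 h1.symm

theorem Induces.unique {i : Fin E.t} (hk : E.k i ≠ 0) {ρ : Perm (Fin n)}
    {π π' : Perm (Fin (E.a i))} (h : E.Induces i ρ π) (h' : E.Induces i ρ π') : π = π' :=
  Equiv.ext fun x => E.factor_injective hk ((h x).symm.trans (h' x))

end PadicExpansion

end SylowTree

/-! ### The actions on the tree functions of characters of `P_n`. -/

theorem theorem2 (p : ℕ) [Fact p.Prime] (u : (ZMod p)ˣ) (hu : orderOf u = p - 1)
    (n : ℕ) (E : SylowTree.PadicExpansion p n) (θ : SylowTree.Irr E.sylow) :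
    -- `θ` is in a unique way a product of irreducible characters of the factors of `P_n`
    (∃! θs : ∀ i, Fin (E.a i) → SylowTree.Irr (SylowTree.P p (E.k i)), E.IsProd θ θs) ∧
    ∀ θs : ∀ i, Fin (E.a i) → SylowTree.Irr (SylowTree.P p (E.k i)), E.IsProd θ θs →
      -- `𝒯(θ)` is the tuple of the `𝒯(θ_{(i,j)})`, and it lies in `ℱ_n`
      (∀ i j, E.tree θ i j = SylowTree.tree (θs i j) ∧
        E.tree θ i j ∈ SylowTree.admissibleTrees p (E.k i)) ∧
      -- the action of `σ(i,j,ℓ)`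
      (∀ (i : Fin E.t) (j : Fin (E.a i)) (ℓ : ℕ), 1 ≤ ℓ → ℓ ≤ E.k i →
        ∃ (hσ : E.sigma u i j ℓ ∈ E.N)
          (hσ' : SylowTree.sigma u (E.k i) ℓ ∈ Subgroup.normalizer
            (SylowTree.P p (E.k i) : Set (Equiv.Perm (Fin (p ^ E.k i))))),
          E.tree (θ.conj hσ) i j = SylowTree.tree ((θs i j).conj hσ') ∧
          (∀ t : SylowTree.Labeling p (E.k i), t.toTree = SylowTree.tree (θs i j) →
            SylowTree.tree ((θs i j).conj hσ') = (t.sigmaAct u ℓ).toTree) ∧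
          (∀ j', j' ≠ j → E.tree (θ.conj hσ) i j' = SylowTree.tree (θs i j')) ∧
          (∀ i', i' ≠ i → ∀ j', E.tree (θ.conj hσ) i' j' = SylowTree.tree (θs i' j'))) ∧
      -- the action of `⟨ξ_y, ζ_y⟩`
      (∀ y : Fin E.t,
        Nonempty (E.rhoGroup y ≃* Equiv.Perm (Fin (E.a y))) ∧
        ∀ ρ ∈ E.rhoGroup y, ∃ hρ : ρ ∈ E.N,
          (∃ π, E.Induces y ρ π) ∧
          ∀ π, E.Induces y ρ π →
            (∀ j, E.tree (θ.conj hρ) y j = SylowTree.tree (θs y (π⁻¹ j))) ∧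
            (∀ z, z ≠ y → ∀ j, E.tree (θ.conj hρ) z j = SylowTree.tree (θs z j))) := by
  refine ⟨?_, fun θs hθs => ⟨fun i j => ?_, fun i j ℓ _ _ => ?_, fun y => ⟨?_, ?_⟩⟩⟩
  · obtain ⟨θs, hθs⟩ := E.exists_isProd θ
    exact ⟨θs, hθs, fun θs' h => SylowTree.PadicExpansion.IsProd.unique E h hθs⟩
  · rw [hθs.tree_eq]
    exact ⟨rfl, SylowTree.tree_mem_admissibleTrees _⟩
  · have hσ' := SylowTree.sigma_mem_normalizer u (E.k i) ℓ
    -- `σ(i,j,ℓ)` as a family over all blocks, trivial except at `(i, j)`, so that conjugation can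
    -- be computed componentwise.
    let h : ∀ i, Fin (E.a i) → Equiv.Perm (Fin (p ^ E.k i)) :=
      Pi.mulSingle i (Pi.mulSingle j (SylowTree.sigma u (E.k i) ℓ))
    have hself : h i j = SylowTree.sigma u (E.k i) ℓ := by simp [h]
    have hj : ∀ j', j' ≠ j → h i j' = 1 := fun j' hj' => by simp [h, Pi.mulSingle_eq_of_ne hj']
    have hi : ∀ i', i' ≠ i → ∀ j', h i' j' = 1 := fun i' hi' j' => by
      simp [h, Pi.mulSingle_eq_of_ne hi']
    have hh : ∀ i' j', h i' j' ∈ Subgroup.normalizer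
        (SylowTree.P p (E.k i') : Set (Equiv.Perm (Fin (p ^ E.k i')))) := by
      intro i' j'
      by_cases hi' : i' = i
      · subst hi'
        by_cases hj' : j' = j
        · subst hj'
          exact hself ▸ hσ'
        · exact hj j' hj' ▸ one_mem _
      · exact hi i' hi' j' ▸ one_mem _
    have hσ : E.sigma u i j ℓ ∈ E.N := E.blockHom_mem_N h hh
    have hp := SylowTree.PadicExpansion.IsProd.conj_blockHom E hθs h hh hσ
    refine ⟨hσ, hσ', ?_, fun t ht => SylowTree.tree_conj_sigma u ℓ _ hσ' t ht,
      fun j' hj' => ?_, fun i' hi' j' => ?_⟩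
    · exact (hp.tree_eq E i j).trans
        (congrArg SylowTree.tree (SylowTree.Irr.conj_congr _ _ hσ' hself))
    · exact (hp.tree_eq E i j').trans
        (congrArg SylowTree.tree (SylowTree.Irr.conj_of_eq_one _ _ (hj j' hj')))
    · exact (hp.tree_eq E i' j').trans
        (congrArg SylowTree.tree (SylowTree.Irr.conj_of_eq_one _ _ (hi i' hi' j')))
  · exact E.nonempty_rhoGroup_mulEquiv y
  · intro ρ hρ
    rw [E.rhoGroup_eq_range] at hρ
    obtain ⟨π₀, rfl⟩ := hρ
    have hN := E.permBlocks_mem_N y π₀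
    have hp := SylowTree.PadicExpansion.IsProd.conj_permBlocks E hθs y π₀ hN
    refine ⟨hN, ⟨π₀, E.permBlocks_induces y π₀⟩, fun π hπ => ⟨fun j => ?_, fun z hz j => ?_⟩⟩
    -- For blocks of length `1` the conjugation action on the trivial factors does not determine
    -- `π`, but there is only one tree function. Otherwise `π` must be the permutation `π₀` from
    -- which `ρ` arises.
    · by_cases hk : E.k y = 0
      · have : Subsingleton (SylowTree.TreeFun p (E.k y)) := by rw [hk]; infer_instance
        exact Subsingleton.elim _ _
      · obtain rfl := SylowTree.PadicExpansion.Induces.unique E hk hπ (E.permBlocks_induces y π₀)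
        refine (hp.tree_eq E y j).trans ?_
        rw [Function.update_self]
    · refine (hp.tree_eq E z j).trans ?_
      rw [Function.update_of_ne hz]
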